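/- **Setting.** Let $n\ge 2$, $d=2^n$, and let $\mathbb P_n=\{\mathbb I,X,Y,Z\}^{\otimes n}$ be the set of $n$-qubit Pauli strings; $|P|$ is the number of non-identity tensor factors of $P$. For a Hermitian $H$ on $n$ qubits let $\alpha_P=\mathrm{Tr}[HP]/2^n$. For $S\subseteq\mathbb P_n$ write $H\in\Pi_S$ if $\alpha_P=0$ for all $P\notin S$; $H$ is $k$-local if $H\in\Pi_S$ for $S=S_{k\text{-loc}}=\{P:|P|\le k\}$. Let $G_1,\dots,G_{d+1}$ be subgroups of the Pauli group modulo phases that cover it, each of order $d$, each equal to its own centralizer, with pairwise trivial intersections (such subgroups exist for every $n \ge 2$). Fix signs $\zeta_{i,p}\in\{\pm1\}$ such that the operators $S_i(p)=\zeta_{i,p}P(p)$, $p\in G_i$, form a group, and representatives $r^i_1,\dots,r^i_d$ of the cosets of $G_i$. Let $|\phi_{i,j}\rangle$ be the stabilizer states with $|\phi_{i,j}\rangle\langle\phi_{i,j}|=\frac1d\sum_{p\in G_i}(-1)^{p\circ r^i_j}S_i(p)$, where $p\circ r$ is $0$ if $P(p)$ and $P(r)$ commute and $1$ if they anticommute.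 Write $\phi\sim_S\psi$ if $|\langle\phi|P|\psi\rangle|=1$ for some $P\in S\cup\{\mathbb I\}$. **Algorithm** (input: $S$ as a list of Pauli strings, $\varepsilon\in(0,1)$, and black-box access to the time evolution under $H$). Set $t=\varepsilon/6$ and $N=\lceil 2\log 3/(t^2\varepsilon^2)\rceil$. For $s=1,\dots,N$: sample $i\in\{1,\dots,d+1\}$ and $j\in\{1,\dots,d\}$ uniformly, prepare $|\phi_{i,j}\rangle$, evolve it under $e^{-\mathrm itH}$, measure in the basis $\{|\phi_{i,\ell}\rangle\}_\ell$, and let $\ell$ be the outcome; if $\phi_{i,j}\not\sim_S\phi_{i,\ell}$, return $H_1$ and stop. After $N$ rounds without stopping, return $H_0$. **Statement.** There are an absolute constant $C$ and one classical program (on a unit-cost random access machine whose only arithmetic operation is the successor), independent of all other data, that decides $\phi_{i,j}\sim_S\phi_{i,\ell}$ from $n$, $r^i_j$, $r^i_\ell$, a list of $n$ generators of $G_i$ and the list $S$, such that the following holds for all choices of the $G_i$ and of their generators, signs and representatives. Let $n\ge2$, $k\ge 0$ and $0<\varepsilon<1$ satisfy $$(3n)^{k+1}\le\frac{(2^n+1)\varepsilon^4}{144},$$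 and let $H$ be an $n$-qubit Hamiltonian with $\mathrm{Tr}(H)=0$ and $\|H\|_\infty\le1$. Run the algorithm with $S=S_{k\text{-loc}}$ (listed without repetition), using the program to decide $\sim_S$. Then: 1. if $H$ is $k$-local, it returns $H_0$ with probability at least $2/3$; 2. if $\frac1{\sqrt{2^n}}\|H-K\|_2\ge\varepsilon$ for every $k$-local Hamiltonian $K$, it returns $H_1$ with probability at least $2/3$; 3. it uses at most $N\le C/\varepsilon^4$ experiments and, in every run, a total evolution time of at most $C/\varepsilon^3$ and a total classical processing time of at most $C(3n)^{k+3}/\varepsilon^4$, where each round's classical time counts the length of the input bit string of the program, the number of its steps, and one step for the loop. -/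

import Mathlib

open scoped Matrix

/-! ### Pauli strings and Hamiltonians -/

/-- Computational basis of `n` qubits. -/
abbrev QubitBasis (n : ℕ) : Type := Fin n → Fin 2

/-- Operators on `n` qubits, as matrices of size `2 ^ n`. -/
abbrev QubitOp (n : ℕ) : Type := Matrix (QubitBasis n) (QubitBasis n) ℂ

/-- Pauli strings on `n` qubits: qubit `q` carries the bit pair `(x, z)`, where
`(0,0), (1,0), (1,1), (0,1)` stand for `I, X, Y, Z`. Addition is multiplication of Pauli
operators modulo phases, so this additive group is the Pauli group modulo phases. -/
abbrev PauliLabel (n : ℕ) : Type := Fin n → ZMod 2 × ZMod 2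

/-- The single-qubit Pauli matrices. -/
def pauliMatrix (p : ZMod 2 × ZMod 2) : Matrix (Fin 2) (Fin 2) ℂ :=
  if p = (0, 0) then !![1, 0; 0, 1]
  else if p = (1, 0) then !![0, 1; 1, 0]
  else if p = (1, 1) then !![0, -Complex.I; Complex.I, 0]
  else !![1, 0; 0, -1]

/-- The tensor product of the single-qubit Pauli matrices of a string. -/
def pauliString {n : ℕ} (P : PauliLabel n) : QubitOp n :=
  Matrix.of fun a b => ∏ q, pauliMatrix (P q) (a q) (b q)

/-- The number of non-identity tensor factors. -/
def pauliWeight {n : ℕ} (P : PauliLabel n) : ℕ :=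
  (Finset.univ.filter fun q => P q ≠ 0).card

/-- The coefficient `Tr[H P] / 2 ^ n` of `H` in the Pauli basis. -/
noncomputable def pauliCoeff {n : ℕ} (H : QubitOp n) (P : PauliLabel n) : ℂ :=
  (H * pauliString P).trace / 2 ^ n

/-- `H` is a Hamiltonian all of whose Pauli terms are in `S`. -/
def HasPauliProperty {n : ℕ} (S : Set (PauliLabel n)) (H : QubitOp n) : Prop :=
  H.IsHermitian ∧ ∀ P, P ∉ S → pauliCoeff H P = 0

/-- The Pauli strings of weight at most `k`. -/
def localPaulis (n k : ℕ) : Set (PauliLabel n) := {P | pauliWeight P ≤ k}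

/-- The Schatten `∞`-norm: the operator norm on the Euclidean space. -/
noncomputable def opNorm {n : ℕ} (A : QubitOp n) : ℝ :=
  ‖Matrix.toEuclideanCLM (𝕜 := ℂ) A‖

/-- The Schatten `2`-norm `(Tr[A† A])^(1/2)`. -/
noncomputable def schattenTwoNorm {n : ℕ} (A : QubitOp n) : ℝ :=
  √(Aᴴ * A).trace.re

/-- `H` is `ε`-far, in the normalized Frobenius norm, from every Hamiltonian whose Pauli terms
are all in `S`. -/
def IsFarFrom {n : ℕ} (S : Set (PauliLabel n)) (ε : ℝ) (H : QubitOp n) : Prop :=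
  ∀ K : QubitOp n, HasPauliProperty S K → ε ≤ 1 / √((2 : ℝ) ^ n) * schattenTwoNorm (H - K)

/-- The channel `ρ ↦ exp(-itH) ρ exp(itH)`. -/
noncomputable def evolve {n : ℕ} (H : QubitOp n) (t : ℝ) (ρ : QubitOp n) : QubitOp n :=
  NormedSpace.exp ((-(Complex.I * t)) • H) * ρ * NormedSpace.exp ((Complex.I * t) • H)

/-! ### Stabilizer bases -/

open Classical in
/-- `(-1) ^ (p ∘ r)`: the sign is `+1` if the two Pauli strings commute and `-1` otherwise. -/
noncomputable def commSign {n : ℕ} (p r : PauliLabel n) : ℂ :=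
  if Commute (pauliString p) (pauliString r) then 1 else -1

/-- A covering of the Pauli group modulo phases by `2 ^ n + 1` maximal Abelian subgroups with
pairwise trivial intersection, with signs that turn each of them into a stabilizer group, with
`n` generators of each, and with a numbering of its cosets by representatives. -/
structure StabilizerCover (n : ℕ) where
  group : Fin (2 ^ n + 1) → AddSubgroup (PauliLabel n)
  card_group : ∀ i, Nat.card (group i) = 2 ^ n
  centralizer_group : ∀ i g,
    (∀ h ∈ group i, Commute (pauliString g) (pauliString h)) ↔ g ∈ group i
  group_inter : ∀ i i', i ≠ i' → group i ⊓ group i' = ⊥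
  group_cover : ∀ g, ∃ i, g ∈ group i
  sign : Fin (2 ^ n + 1) → PauliLabel n → ℤˣ
  sign_mul : ∀ i, ∀ g ∈ group i, ∀ h ∈ group i,
    (((sign i g : ℤ) : ℂ) • pauliString g) * (((sign i h : ℤ) : ℂ) • pauliString h) =
      ((sign i (g + h) : ℤ) : ℂ) • pauliString (g + h)
  gen : Fin (2 ^ n + 1) → Fin n → PauliLabel n
  closure_gen : ∀ i, AddSubgroup.closure (Set.range (gen i)) = group i
  rep : Fin (2 ^ n + 1) → Fin (2 ^ n) → PauliLabel n
  rep_bijective : ∀ i, Function.Bijective fun j =>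
    (QuotientAddGroup.mk (rep i j) : PauliLabel n ⧸ group i)

open Classical in
/-- The stabilizer state `|φ_{i,j}⟩⟨φ_{i,j}| = 2^{-n} ∑_{p ∈ G_i} (-1)^{p ∘ r_j} S(p)`. -/
noncomputable def StabilizerCover.proj {n : ℕ} (B : StabilizerCover n)
    (i : Fin (2 ^ n + 1)) (j : Fin (2 ^ n)) : QubitOp n :=
  (1 / (2 : ℂ) ^ n) • ∑ p ∈ Finset.univ.filter (fun p => p ∈ B.group i),
    commSign p (B.rep i j) • (((B.sign i p : ℤ) : ℂ) • pauliString p)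

/-- A vector `|φ_{i,j}⟩` that represents the pure state `B.proj i j` (unique up to a phase). -/
noncomputable def StabilizerCover.ket {n : ℕ} (B : StabilizerCover n)
    (i : Fin (2 ^ n + 1)) (j : Fin (2 ^ n)) : QubitBasis n → ℂ :=
  Classical.epsilon fun v => Matrix.vecMulVec v (star v) = B.proj i j

/-- The relation `φ ∼_S ψ`: `|⟨φ|P|ψ⟩| = 1` for some `P ∈ S ∪ {I}`. -/
def PauliEquivalent {n : ℕ} (S : Set (PauliLabel n)) (φ ψ : QubitBasis n → ℂ) : Prop :=
  ∃ P ∈ S ∪ {0}, ‖star φ ⬝ᵥ (pauliString P *ᵥ ψ)‖ = 1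

/-! ### Classical machine: a unit-cost successor random access machine

Numbers grow by at most one per step, so unit cost hides no large arithmetic. -/

structure MachineState where
  reg : ℕ → ℕ
  mem : ℕ → ℕ

/-- Programs. In `loop x p` the body `p` is executed as many times as register `x` says when the
loop is entered. -/
inductive RamProgram : Type
  | const (x c : ℕ) : RamProgram
  | copy (x y : ℕ) : RamProgram
  | succ (x : ℕ) : RamProgram
  | load (x y : ℕ) : RamProgram
  | store (x y : ℕ) : RamProgram
  | seq (p q : RamProgram) : RamProgram
  | ifZero (x : ℕ) (p q : RamProgram) : RamProgram
  | loop (x : ℕ) (p : RamProgram) : RamProgram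

/-- Final state and number of steps. -/
def RamProgram.run : RamProgram → MachineState → MachineState × ℕ
  | .const x c, s => ({ s with reg := Function.update s.reg x c }, 1)
  | .copy x y, s => ({ s with reg := Function.update s.reg x (s.reg y) }, 1)
  | .succ x, s => ({ s with reg := Function.update s.reg x (s.reg x + 1) }, 1)
  | .load x y, s => ({ s with reg := Function.update s.reg x (s.mem (s.reg y)) }, 1)
  | .store x y, s => ({ s with mem := Function.update s.mem (s.reg x) (s.reg y) }, 1)
  | .seq p q, s =>
      let r := p.run s
      let r' := q.run r.1
      (r'.1, r.2 + r'.2)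
  | .ifZero x p q, s =>
      let r := if s.reg x = 0 then p.run s else q.run s
      (r.1, r.2 + 1)
  | .loop x p, s =>
      (fun r : MachineState × ℕ =>
        let r' := p.run r.1
        (r'.1, r.2 + r'.2 + 1))^[s.reg x] (s, 1)

/-- A Pauli string as a list of `2 n` bits. -/
def pauliBits {n : ℕ} (P : PauliLabel n) : List ℕ :=
  (List.ofFn fun q => [(P q).1.val, (P q).2.val]).flatten

/-- The input on which `|φ_{i,j}⟩ ∼_S |φ_{i,ℓ}⟩` is decided: the coset representatives `r_j` and
`r_ℓ`, the `n` generators of `G_i`, and the list of the strings in `S`. -/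
def StabilizerCover.testInput {n : ℕ} (B : StabilizerCover n) (L : List (PauliLabel n))
    (i : Fin (2 ^ n + 1)) (j l : Fin (2 ^ n)) : List ℕ :=
  pauliBits (B.rep i j) ++ pauliBits (B.rep i l) ++
    (List.ofFn fun m => pauliBits (B.gen i m)).flatten ++ (L.map pauliBits).flatten

/-- Registers `0` and `1` hold `n` and the length of the list, the memory holds the input bits,
and everything else is `0`. -/
def StabilizerCover.testState {n : ℕ} (B : StabilizerCover n) (L : List (PauliLabel n))
    (i : Fin (2 ^ n + 1)) (j l : Fin (2 ^ n)) : MachineState where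
  reg := fun x => if x = 0 then n else if x = 1 then L.length else 0
  mem := fun a => (B.testInput L i j l).getD a 0

/-- The answer "equivalent" of the program is a nonzero value in register `0`. -/
def StabilizerCover.testAccepts {n : ℕ} (B : StabilizerCover n) (prog : RamProgram)
    (L : List (PauliLabel n)) (i : Fin (2 ^ n + 1)) (j l : Fin (2 ^ n)) : Bool :=
  (prog.run (B.testState L i j l)).1.reg 0 != 0

/-- Classical time of one test: writing down the whole input and running the program. -/
def StabilizerCover.testTime {n : ℕ} (B : StabilizerCover n) (prog : RamProgram)
    (L : List (PauliLabel n)) (i : Fin (2 ^ n + 1)) (j l : Fin (2 ^ n)) : ℕ :=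
  (B.testInput L i j l).length + (prog.run (B.testState L i j l)).2

/-- The program decides the relation `∼_S` between states of one basis, for all numbers of
qubits, all stabilizer bases and all properties `S` given as lists. -/
def DecidesPauliEquivalence (prog : RamProgram) : Prop :=
  ∀ (n : ℕ) (B : StabilizerCover n) (L : List (PauliLabel n))
    (i : Fin (2 ^ n + 1)) (j l : Fin (2 ^ n)),
    B.testAccepts prog L i j l = true ↔ PauliEquivalent {P | P ∈ L} (B.ket i j) (B.ket i l)

/-! ### The tester -/

open Classical in
/-- Born rule: measuring the state `ρ` with the POVM `E` gives outcome `l` with probability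
`Tr[E_l ρ]` (and an arbitrary distribution if `E` and `ρ` do not define one). -/
noncomputable def bornPMF {ι κ : Type} [Fintype ι] [Nonempty ι] [Fintype κ]
    (E : ι → Matrix κ κ ℂ) (ρ : Matrix κ κ ℂ) : PMF ι :=
  if h : ∑ l, ENNReal.ofReal (E l * ρ).trace.re = 1 then
    PMF.ofFintype (fun l => ENNReal.ofReal (E l * ρ).trace.re) h
  else PMF.pure (Classical.arbitrary ι)

/-- One experiment: a uniformly random basis `i` and basis state `j`, evolution for time `t`, and
measurement in basis `i` with outcome `l`. -/
noncomputable def StabilizerCover.experiment {n : ℕ} (B : StabilizerCover n) (H : QubitOp n)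
    (t : ℝ) : PMF (Fin (2 ^ n + 1) × Fin (2 ^ n) × Fin (2 ^ n)) :=
  (PMF.uniformOfFintype (Fin (2 ^ n + 1))).bind fun i =>
    (PMF.uniformOfFintype (Fin (2 ^ n))).bind fun j =>
      (bornPMF (B.proj i) (evolve H t (B.proj i j))).map fun l => (i, j, l)

/-- The two possible outputs `H₀` and `H₁`. -/
inductive Verdict : Type
  | null : Verdict
  | alternate : Verdict

/-- Result of a run of the tester, with the resources used. -/
structure TesterRun where
  verdict : Verdict
  experiments : ℕ
  evolutionTime : ℝ
  classicalTime : ℕ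

/-- At most `N` rounds of the tester, stopping with `H₁` at the first detected violation. Each
round is one experiment, of evolution time `t`, followed by one test of `∼_S` by `prog` (and one
further classical step for the loop). -/
noncomputable def StabilizerCover.rounds {n : ℕ} (B : StabilizerCover n) (prog : RamProgram)
    (L : List (PauliLabel n)) (H : QubitOp n) (t : ℝ) : ℕ → PMF TesterRun
  | 0 => PMF.pure ⟨Verdict.null, 0, 0, 0⟩
  | N + 1 => (B.experiment H t).bind fun x =>
      if B.testAccepts prog L x.1 x.2.1 x.2.2 = true then
        (B.rounds prog L H t N).map fun r =>
          ⟨r.verdict, r.experiments + 1, r.evolutionTime + t,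
            r.classicalTime + B.testTime prog L x.1 x.2.1 x.2.2 + 1⟩
      else PMF.pure ⟨Verdict.alternate, 1, t, B.testTime prog L x.1 x.2.1 x.2.2 + 1⟩

/-- Evolution time per experiment. -/
noncomputable def testerTime (ε : ℝ) : ℝ := ε / 6

/-- Number of rounds. -/
noncomputable def testerRounds (ε : ℝ) : ℕ :=
  ⌈2 * Real.log 3 / (testerTime ε ^ 2 * ε ^ 2)⌉₊

/-- The tester for the property given by the list `L` of Pauli strings, with accuracy `ε`, run on
the Hamiltonian `H`. -/
noncomputable def StabilizerCover.tester {n : ℕ} (B : StabilizerCover n) (prog : RamProgram)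
    (L : List (PauliLabel n)) (ε : ℝ) (H : QubitOp n) : PMF TesterRun :=
  B.rounds prog L H (testerTime ε) (testerRounds ε)

/-!
The tester works because one experiment samples a Pauli string and reveals its coset. Write the
evolution operator as `U = ∑ u_P P`. Since `P φ_r = φ_{r + P}` on the stabilizer states of a basis,
measuring `U φ_{i,j}` in the basis `i` displaces the coset of `r_j` by that of a string `P` drawn
with probability `|u_P|²`, on average over `j` (`StabilizerCover.sum_transition_of_coset`, from the
operator identity `StabilizerCover.sum_smul_projOf_mul_mul_projOf`). The outcome is accepted iff the
coset `P + G_i` meets `S ∪ {I}` (`StabilizerCover.pauliEquivalent_ket_iff`).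

A string of `S` is always accepted. A string outside `S` differs from each element of `S` by a
nonidentity string, which lies in exactly one of the `2 ^ n + 1` groups, so it is accepted in at
most `|S|` of the bases (`StabilizerCover.card_filter_cosetMeets_le`). Hence the rejection
probability of a round agrees with the weight `W = ∑_{P ∉ S} |u_P|²` up to the factor
`1 - |S| / (2 ^ n + 1)`, which is at least `143 / 144` for local strings, as there are at most
`(3 n) ^ (k + 1)` of them (`card_pauliWeight_le`).

The remainder of `U = I - itH + ⋯` has normalized Frobenius norm at most `t²`, by the spectral
theorem (`trace_evolutionRemainder_le`). If `H` has the property, then `W ≤ t⁴`; if it is `ε`-far,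
then `W ≥ (tε - t²)² = (25 / 36) t² ε²`. With `N ≈ 2 log 3 / (t² ε²)` rounds this gives the two
error bounds.

Stabilizer covers exist because the lines through the origin of `F × F`, for the field `F` with
`2 ^ n` elements, are maximal isotropic for the form `tr (a c' + c a')`, which coordinates turn into
the symplectic form on Pauli strings. The signs are the eigenvalues of the strings on a common
eigenvector.

The program tests, for each string `P` of the list and for the identity, whether
`r_j + r_ℓ + P` commutes with all generators of `G_i`, one qubit at a time. Its specification is
proved from the inside of the nested loops outwards with the loop rule `RamProgram.run_loop_spec`.
-/

/-! ### Algebra of Pauli strings -/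

/-- The sign character `x ↦ (-1) ^ x` of `ZMod 2`, with values in `ℂ`. -/
def bitSign (x : ZMod 2) : ℂ := if x = 0 then 1 else -1

theorem bitSign_zero : bitSign 0 = 1 := by simp [bitSign]

theorem bitSign_add (x y : ZMod 2) : bitSign (x + y) = bitSign x * bitSign y := by
  have h : ∀ x : ZMod 2, x = 0 ∨ x = 1 := by decide
  rcases h x with rfl | rfl <;> rcases h y with rfl | rfl <;>
    simp [bitSign, CharTwo.add_self_eq_zero]

theorem bitSign_sum {ι : Type*} (s : Finset ι) (f : ι → ZMod 2) :
    bitSign (∑ i ∈ s, f i) = ∏ i ∈ s, bitSign (f i) := by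
  classical
  induction s using Finset.induction_on with
  | empty => simp [bitSign_zero]
  | insert a s ha ih => rw [Finset.sum_insert ha, Finset.prod_insert ha, bitSign_add, ih]

theorem bitSign_mul_self (x : ZMod 2) : bitSign x * bitSign x = 1 := by
  unfold bitSign; split_ifs <;> simp

theorem star_bitSign (x : ZMod 2) : star (bitSign x) = bitSign x := by
  unfold bitSign; split_ifs <;> simp

/-- The symplectic form on Pauli strings: two strings commute iff it vanishes on them. -/
def symplecticForm {n : ℕ} (p q : PauliLabel n) : ZMod 2 :=
  ∑ k, ((p k).1 * (q k).2 + (p k).2 * (q k).1)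

theorem symplecticForm_add_left {n : ℕ} (p q r : PauliLabel n) :
    symplecticForm (p + q) r = symplecticForm p r + symplecticForm q r := by
  simp only [symplecticForm, ← Finset.sum_add_distrib]
  refine Finset.sum_congr rfl fun k _ => ?_
  simp only [Pi.add_apply, Prod.fst_add, Prod.snd_add]; ring

theorem symplecticForm_comm {n : ℕ} (p q : PauliLabel n) :
    symplecticForm p q = symplecticForm q p := by
  refine Finset.sum_congr rfl fun k _ => ?_
  ring

theorem symplecticForm_add_right {n : ℕ} (p q r : PauliLabel n) :
    symplecticForm p (q + r) = symplecticForm p q + symplecticForm p r := by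
  rw [symplecticForm_comm, symplecticForm_add_left, symplecticForm_comm q, symplecticForm_comm r]

theorem symplecticForm_zero_left {n : ℕ} (p : PauliLabel n) : symplecticForm 0 p = 0 := by
  simp [symplecticForm]

theorem pauliLabel_add_self {n : ℕ} (p : PauliLabel n) : p + p = 0 := by
  funext k
  exact Prod.ext (CharTwo.add_self_eq_zero _) (CharTwo.add_self_eq_zero _)

theorem pauliLabel_neg {n : ℕ} (p : PauliLabel n) : -p = p :=
  neg_eq_of_add_eq_zero_left (pauliLabel_add_self p)

theorem pauliLabel_add_eq_zero_iff {n : ℕ} (p q : PauliLabel n) : p + q = 0 ↔ p = q := by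
  rw [add_eq_zero_iff_eq_neg, pauliLabel_neg]

theorem pauliMatrix_zero : pauliMatrix (0, 0) = 1 := by
  simp [pauliMatrix, Matrix.one_fin_two]

theorem pauliMatrix_one_zero : pauliMatrix (1, 0) = !![0, 1; 1, 0] := by
  simp [pauliMatrix]

theorem pauliMatrix_one_one : pauliMatrix (1, 1) = !![0, -Complex.I; Complex.I, 0] := by
  simp [pauliMatrix]

theorem pauliMatrix_zero_one : pauliMatrix (0, 1) = !![1, 0; 0, -1] := by
  simp [pauliMatrix]

theorem zmod_two_pair_cases (p : ZMod 2 × ZMod 2) :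
    p = (0, 0) ∨ p = (1, 0) ∨ p = (1, 1) ∨ p = (0, 1) := by
  revert p; decide

theorem pauliMatrix_mul_comm (p q : ZMod 2 × ZMod 2) :
    pauliMatrix p * pauliMatrix q =
      bitSign (p.1 * q.2 + p.2 * q.1) • (pauliMatrix q * pauliMatrix p) := by
  rcases zmod_two_pair_cases p with rfl | rfl | rfl | rfl <;>
  rcases zmod_two_pair_cases q with rfl | rfl | rfl | rfl <;>
  simp [pauliMatrix_zero, pauliMatrix_one_zero, pauliMatrix_one_one, pauliMatrix_zero_one, bitSign,
    CharTwo.add_self_eq_zero]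

theorem pauliMatrix_mul_eq_smul (p q : ZMod 2 × ZMod 2) :
    ∃ c : ℂ, pauliMatrix p * pauliMatrix q = c • pauliMatrix (p + q) := by
  have key : pauliMatrix p * pauliMatrix q = (1 : ℂ) • pauliMatrix (p + q) ∨
      pauliMatrix p * pauliMatrix q = Complex.I • pauliMatrix (p + q) ∨
      pauliMatrix p * pauliMatrix q = (-Complex.I) • pauliMatrix (p + q) := by
    rcases zmod_two_pair_cases p with rfl | rfl | rfl | rfl <;>
    rcases zmod_two_pair_cases q with rfl | rfl | rfl | rfl <;>
    simp [pauliMatrix_zero, pauliMatrix_one_zero, pauliMatrix_one_one, pauliMatrix_zero_one,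
      CharTwo.add_self_eq_zero, Matrix.one_fin_two]
  rcases key with h | h | h <;> exact ⟨_, h⟩

theorem pauliMatrix_trace_mul (p q : ZMod 2 × ZMod 2) :
    (pauliMatrix p * pauliMatrix q).trace = if p = q then 2 else 0 := by
  rcases zmod_two_pair_cases p with rfl | rfl | rfl | rfl <;>
  rcases zmod_two_pair_cases q with rfl | rfl | rfl | rfl <;>
  simp [pauliMatrix_zero, pauliMatrix_one_zero, pauliMatrix_one_one, pauliMatrix_zero_one,
    Matrix.trace_fin_two_of, one_add_one_eq_two]

theorem pauliMatrix_conjTranspose (p : ZMod 2 × ZMod 2) :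
    (pauliMatrix p)ᴴ = pauliMatrix p := by
  rcases zmod_two_pair_cases p with rfl | rfl | rfl | rfl <;>
  ext i j <;> fin_cases i <;> fin_cases j <;>
  simp [pauliMatrix_zero, pauliMatrix_one_zero, pauliMatrix_one_one, pauliMatrix_zero_one]

theorem pauliMatrix_mul_self (p : ZMod 2 × ZMod 2) : pauliMatrix p * pauliMatrix p = 1 := by
  rcases zmod_two_pair_cases p with rfl | rfl | rfl | rfl <;>
  simp [pauliMatrix_zero, pauliMatrix_one_zero, pauliMatrix_one_one, pauliMatrix_zero_one,
    Matrix.one_fin_two]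

theorem sum_pauliMatrix_mul (a b c d : Fin 2) :
    ∑ p, pauliMatrix p a b * pauliMatrix p c d = if a = d ∧ b = c then 2 else 0 := by
  have h : (Finset.univ : Finset (ZMod 2 × ZMod 2)) = {(0, 0), (1, 0), (1, 1), (0, 1)} := by
    decide
  rw [h]
  fin_cases a <;> fin_cases b <;> fin_cases c <;> fin_cases d <;>
    simp [pauliMatrix_zero, pauliMatrix_one_zero, pauliMatrix_one_one, pauliMatrix_zero_one,
      one_add_one_eq_two]

theorem pauliString_mul_apply {n : ℕ} (p q : PauliLabel n) (a b : QubitBasis n) :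
    (pauliString p * pauliString q) a b =
      ∏ k, (pauliMatrix (p k) * pauliMatrix (q k)) (a k) (b k) := by
  simp only [Matrix.mul_apply, pauliString, Matrix.of_apply, ← Finset.prod_mul_distrib]
  rw [Finset.prod_univ_sum]
  simp [Fintype.piFinset_univ]

theorem pauliString_mul_comm {n : ℕ} (p q : PauliLabel n) :
    pauliString p * pauliString q =
      bitSign (symplecticForm p q) • (pauliString q * pauliString p) := by
  ext a b
  rw [Matrix.smul_apply, pauliString_mul_apply, pauliString_mul_apply, symplecticForm, bitSign_sum,
    smul_eq_mul, ← Finset.prod_mul_distrib]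
  refine Finset.prod_congr rfl fun k _ => ?_
  rw [pauliMatrix_mul_comm]; rfl

theorem pauliString_mul_eq_smul {n : ℕ} (p q : PauliLabel n) :
    ∃ c : ℂ, pauliString p * pauliString q = c • pauliString (p + q) := by
  choose c hc using pauliMatrix_mul_eq_smul
  refine ⟨∏ k, c (p k) (q k), ?_⟩
  ext a b
  rw [Matrix.smul_apply, pauliString_mul_apply, pauliString, Matrix.of_apply, smul_eq_mul,
    ← Finset.prod_mul_distrib]
  refine Finset.prod_congr rfl fun k _ => ?_
  rw [hc]; rfl

theorem pauliString_trace_mul {n : ℕ} (p q : PauliLabel n) :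
    (pauliString p * pauliString q).trace = if p = q then 2 ^ n else 0 := by
  have h : (pauliString p * pauliString q).trace =
      ∏ k, (pauliMatrix (p k) * pauliMatrix (q k)).trace := by
    simp only [Matrix.trace, Matrix.diag_apply, pauliString_mul_apply]
    rw [Finset.prod_univ_sum]
    simp [Fintype.piFinset_univ]
  rw [h]
  simp only [pauliMatrix_trace_mul]
  split_ifs with hpq
  · simp [hpq]
  · obtain ⟨k, hk⟩ := Function.ne_iff.mp hpq
    exact Finset.prod_eq_zero (Finset.mem_univ k) (by simp [hk])

theorem pauliString_conjTranspose {n : ℕ} (p : PauliLabel n) :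
    (pauliString p)ᴴ = pauliString p := by
  ext a b
  simp only [Matrix.conjTranspose_apply, pauliString, Matrix.of_apply, star_prod]
  refine Finset.prod_congr rfl fun k _ => ?_
  conv_rhs => rw [← pauliMatrix_conjTranspose]
  rfl

theorem pauliString_mul_self {n : ℕ} (p : PauliLabel n) : pauliString p * pauliString p = 1 := by
  ext a b
  simp only [pauliString_mul_apply, pauliMatrix_mul_self, Matrix.one_apply, funext_iff]
  split_ifs with h
  · simp [h]
  · obtain ⟨k, hk⟩ := not_forall.mp h
    exact Finset.prod_eq_zero (Finset.mem_univ k) (by simp [hk])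

theorem pauliString_zero {n : ℕ} : pauliString (0 : PauliLabel n) = 1 := by
  have h1 : pauliMatrix 0 = 1 := pauliMatrix_zero
  ext a b
  simp only [pauliString, Matrix.of_apply, Matrix.one_apply, funext_iff, Pi.zero_apply, h1]
  split_ifs with h
  · simp [h]
  · obtain ⟨k, hk⟩ := not_forall.mp h
    exact Finset.prod_eq_zero (Finset.mem_univ k) (by simp [hk])

theorem pauliString_trace {n : ℕ} (p : PauliLabel n) :
    (pauliString p).trace = if p = 0 then 2 ^ n else 0 := by
  rw [← pauliString_trace_mul, pauliString_zero, mul_one]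

theorem commute_pauliString_iff {n : ℕ} (p q : PauliLabel n) :
    Commute (pauliString p) (pauliString q) ↔ symplecticForm p q = 0 := by
  constructor
  · intro h
    by_contra h0
    have h1 : pauliString p * pauliString q = (-1 : ℂ) • (pauliString p * pauliString q) := by
      nth_rewrite 1 [pauliString_mul_comm]
      rw [bitSign, if_neg h0, h.eq]
    have h2 : pauliString p * pauliString q = 0 := by
      ext a b
      have h3 := congrFun (congrFun h1 a) b
      simp only [Matrix.smul_apply, smul_eq_mul] at h3
      simp only [Matrix.zero_apply]
      linear_combination h3 / 2
    have h4 : (1 : QubitOp n) = 0 := by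
      calc (1 : QubitOp n) = pauliString p * (pauliString p * pauliString q) * pauliString q := by
            rw [← mul_assoc, pauliString_mul_self, one_mul, pauliString_mul_self]
        _ = 0 := by rw [h2]; simp
    have h5 := congrFun (congrFun h4 0) 0
    simp at h5
  · intro h
    rw [Commute, SemiconjBy, pauliString_mul_comm, h, bitSign_zero, one_smul]

theorem commSign_eq {n : ℕ} (p q : PauliLabel n) :
    commSign p q = bitSign (symplecticForm p q) := by
  simp [commSign, bitSign, commute_pauliString_iff]

/-- Completeness of the Pauli strings, entry by entry. -/
theorem sum_pauliString_mul_apply {n : ℕ} (a b c d : QubitBasis n) :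
    ∑ p : PauliLabel n, pauliString p a b * pauliString p c d =
      if a = d ∧ b = c then 2 ^ n else 0 := by
  simp only [pauliString, Matrix.of_apply, ← Finset.prod_mul_distrib]
  have h := Finset.prod_univ_sum (fun _ : Fin n => (Finset.univ : Finset (ZMod 2 × ZMod 2)))
    (fun k p => pauliMatrix p (a k) (b k) * pauliMatrix p (c k) (d k))
  rw [Fintype.piFinset_univ] at h
  rw [← h]
  simp only [sum_pauliMatrix_mul]
  split_ifs with hab
  · simp [hab.1, hab.2]
  · have : ∃ k, ¬ (a k = d k ∧ b k = c k) := by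
      by_contra! hc
      exact hab ⟨funext fun k => (hc k).1, funext fun k => (hc k).2⟩
    obtain ⟨k, hk⟩ := this
    exact Finset.prod_eq_zero (Finset.mem_univ k) (by simp only [if_neg hk])

/-- The Pauli expansion of an operator. -/
theorem sum_pauliCoeff_smul {n : ℕ} (A : QubitOp n) :
    ∑ p, pauliCoeff A p • pauliString p = A := by
  ext c d
  have h2 : (2 : ℂ) ^ n ≠ 0 := pow_ne_zero n two_ne_zero
  simp only [Matrix.sum_apply, Matrix.smul_apply, smul_eq_mul, pauliCoeff, Matrix.trace,
    Matrix.diag_apply, Matrix.mul_apply]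
  calc ∑ p : PauliLabel n, (∑ b, ∑ a, A b a * pauliString p a b) / 2 ^ n * pauliString p c d
      = ∑ b, ∑ a, A b a / 2 ^ n * ∑ p, pauliString p a b * pauliString p c d := by
        simp only [Finset.sum_div, Finset.sum_mul, Finset.mul_sum]
        rw [Finset.sum_comm]
        refine Finset.sum_congr rfl fun b _ => ?_
        rw [Finset.sum_comm]
        refine Finset.sum_congr rfl fun a _ => Finset.sum_congr rfl fun p _ => ?_
        ring
    _ = A c d := by
        simp only [sum_pauliString_mul_apply]
        rw [Finset.sum_eq_single c, Finset.sum_eq_single d]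
        · simp [h2]
        · intro a _ ha; simp [ha]
        · simp
        · intro b _ hb; simp [hb]
        · simp

theorem pauliCoeff_sum_smul {n : ℕ} (u : PauliLabel n → ℂ) (q : PauliLabel n) :
    pauliCoeff (∑ p, u p • pauliString p) q = u q := by
  have h2 : (2 : ℂ) ^ n ≠ 0 := pow_ne_zero n two_ne_zero
  simp [pauliCoeff, Finset.sum_mul, Matrix.trace_sum, pauliString_trace_mul, h2]

theorem trace_mul_conjTranspose_eq_sum {n : ℕ} (A B : QubitOp n) :
    (A * Bᴴ).trace = 2 ^ n * ∑ p, pauliCoeff A p * star (pauliCoeff B p) := by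
  have h2 : (2 : ℂ) ^ n ≠ 0 := pow_ne_zero n two_ne_zero
  nth_rewrite 1 [← sum_pauliCoeff_smul B]
  rw [Matrix.conjTranspose_sum, Finset.mul_sum, Matrix.trace_sum, Finset.mul_sum]
  refine Finset.sum_congr rfl fun p _ => ?_
  rw [Matrix.conjTranspose_smul, pauliString_conjTranspose, Matrix.mul_smul, Matrix.trace_smul,
    smul_eq_mul, mul_comm, ← mul_assoc]
  congr 1
  rw [pauliCoeff, mul_div_cancel₀ _ h2]

/-- Parseval's identity for the Pauli expansion. -/
theorem trace_conjTranspose_mul_self_eq {n : ℕ} (A : QubitOp n) :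
    (Aᴴ * A).trace = ((2 ^ n * ∑ p, ‖pauliCoeff A p‖ ^ 2 : ℝ) : ℂ) := by
  rw [Matrix.trace_mul_comm, trace_mul_conjTranspose_eq_sum]
  push_cast
  congr 1
  refine Finset.sum_congr rfl fun p _ => ?_
  exact Complex.mul_conj' _

/-! ### Stabilizer projectors -/

namespace StabilizerCover

variable {n : ℕ} (B : StabilizerCover n) (i : Fin (2 ^ n + 1))

theorem mem_group_iff (g : PauliLabel n) :
    g ∈ B.group i ↔ ∀ h ∈ B.group i, symplecticForm g h = 0 := by
  simp only [← B.centralizer_group i g, commute_pauliString_iff]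

theorem symplecticForm_eq_zero {g h : PauliLabel n} (hg : g ∈ B.group i) (hh : h ∈ B.group i) :
    symplecticForm g h = 0 :=
  (B.mem_group_iff i g).mp hg h hh

/-- The signed Pauli string `S_i(p)`. -/
noncomputable def signedPauli (p : PauliLabel n) : QubitOp n :=
  ((B.sign i p : ℤ) : ℂ) • pauliString p

open Classical in
/-- The elements of the stabilizer group as a finite set. -/
noncomputable def groupFinset : Finset (PauliLabel n) :=
  Finset.univ.filter fun p => p ∈ B.group i

theorem mem_groupFinset (p : PauliLabel n) : p ∈ B.groupFinset i ↔ p ∈ B.group i := by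
  simp [groupFinset]

theorem card_groupFinset : (B.groupFinset i).card = 2 ^ n := by
  classical
  rw [← B.card_group i, Nat.card_eq_fintype_card, groupFinset, Fintype.card_subtype]

/-- The stabilizer state attached to an arbitrary Pauli string `r`; it depends only on the coset
of `r`. -/
noncomputable def projOf (r : PauliLabel n) : QubitOp n :=
  (1 / (2 : ℂ) ^ n) • ∑ p ∈ B.groupFinset i, bitSign (symplecticForm p r) • B.signedPauli i p

theorem proj_eq_projOf (j : Fin (2 ^ n)) : B.proj i j = B.projOf i (B.rep i j) := by
  simp only [proj, projOf, commSign_eq, signedPauli, groupFinset]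

theorem signedPauli_mul {p q : PauliLabel n} (hp : p ∈ B.group i) (hq : q ∈ B.group i) :
    B.signedPauli i p * B.signedPauli i q = B.signedPauli i (p + q) :=
  B.sign_mul i p hp q hq

theorem signedPauli_zero : B.signedPauli i 0 = 1 := by
  have h := B.sign_mul i 0 (B.group i).zero_mem 0 (B.group i).zero_mem
  rw [add_zero, pauliString_zero] at h
  have h0 := congrFun (congrFun h 0) 0
  simp only [Matrix.smul_mul, one_mul, Matrix.smul_apply, Matrix.one_apply_eq, smul_eq_mul,
    mul_one] at h0
  have hs : B.sign i 0 = 1 := by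
    rcases Int.units_eq_one_or (B.sign i 0) with h1 | h1
    · exact h1
    · rw [h1] at h0; norm_num at h0
  simp [signedPauli, hs, pauliString_zero]

theorem signedPauli_trace (p : PauliLabel n) :
    (B.signedPauli i p).trace = if p = 0 then 2 ^ n else 0 := by
  split_ifs with h
  · rw [h, signedPauli_zero]; simp
  · simp [signedPauli, Matrix.trace_smul, pauliString_trace, h]

theorem signedPauli_conjTranspose (p : PauliLabel n) :
    (B.signedPauli i p)ᴴ = B.signedPauli i p := by
  simp [signedPauli, Matrix.conjTranspose_smul, pauliString_conjTranspose]

theorem pauliString_mul_signedPauli (p q : PauliLabel n) :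
    pauliString p * B.signedPauli i q =
      bitSign (symplecticForm q p) • (B.signedPauli i q * pauliString p) := by
  rw [signedPauli, Matrix.mul_smul, pauliString_mul_comm, symplecticForm_comm, Matrix.smul_mul,
    smul_comm]

theorem sum_groupFinset_add {M : Type*} [AddCommMonoid M] {p : PauliLabel n} (hp : p ∈ B.group i)
    (f : PauliLabel n → M) :
    ∑ q ∈ B.groupFinset i, f (p + q) = ∑ q ∈ B.groupFinset i, f q := by
  refine Finset.sum_nbij' (fun q => p + q) (fun q => p + q) ?_ ?_ ?_ ?_ ?_
  · intro q hq
    rw [mem_groupFinset] at hq ⊢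
    exact (B.group i).add_mem hp hq
  · intro q hq
    rw [mem_groupFinset] at hq ⊢
    exact (B.group i).add_mem hp hq
  · intro q _
    rw [← add_assoc, pauliLabel_add_self, zero_add]
  · intro q _
    rw [← add_assoc, pauliLabel_add_self, zero_add]
  · intro q _
    rfl

open Classical in
/-- Orthogonality of characters of the stabilizer group. -/
theorem sum_bitSign_symplecticForm (c : PauliLabel n) :
    ∑ p ∈ B.groupFinset i, bitSign (symplecticForm p c) =
      if c ∈ B.group i then 2 ^ n else 0 := by
  split_ifs with hc
  · rw [Finset.sum_congr rfl (g := fun _ => (1 : ℂ))]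
    · simp [card_groupFinset]
    · intro p hp
      rw [B.symplecticForm_eq_zero i ((B.mem_groupFinset i p).mp hp) hc, bitSign_zero]
  · rw [mem_group_iff] at hc
    push Not at hc
    obtain ⟨h, hh, hne⟩ := hc
    have h1 := B.sum_groupFinset_add i hh fun p => bitSign (symplecticForm p c)
    simp only [symplecticForm_add_left, bitSign_add, ← Finset.mul_sum] at h1
    rw [symplecticForm_comm, bitSign, if_neg hne] at h1
    linear_combination (-1 / 2) * h1

open Classical in
theorem projOf_mul (r r' : PauliLabel n) :
    B.projOf i r * B.projOf i r' = if r + r' ∈ B.group i then B.projOf i r' else 0 := by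
  have h2 : (2 : ℂ) ^ n ≠ 0 := pow_ne_zero n two_ne_zero
  have key : (∑ p ∈ B.groupFinset i, bitSign (symplecticForm p r) • B.signedPauli i p) *
      (∑ q ∈ B.groupFinset i, bitSign (symplecticForm q r') • B.signedPauli i q) =
      (∑ p ∈ B.groupFinset i, bitSign (symplecticForm p (r + r'))) •
        ∑ q ∈ B.groupFinset i, bitSign (symplecticForm q r') • B.signedPauli i q := by
    rw [Finset.sum_mul, Finset.sum_smul]
    refine Finset.sum_congr rfl fun p hp => ?_
    rw [mem_groupFinset] at hp
    -- The sum over the second group element is shifted by the first one.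
    conv_rhs =>
      rw [← B.sum_groupFinset_add i hp fun q => bitSign (symplecticForm q r') • B.signedPauli i q]
    rw [Finset.mul_sum, Finset.smul_sum]
    refine Finset.sum_congr rfl fun q hq => ?_
    rw [mem_groupFinset] at hq
    rw [Matrix.smul_mul, Matrix.mul_smul, B.signedPauli_mul i hp hq, smul_smul, smul_smul]
    congr 1
    rw [symplecticForm_add_left, symplecticForm_add_right, bitSign_add, bitSign_add]
    linear_combination (-bitSign (symplecticForm p r) * bitSign (symplecticForm q r')) *
      bitSign_mul_self (symplecticForm p r')
  rw [projOf, projOf, Matrix.smul_mul, Matrix.mul_smul, key, sum_bitSign_symplecticForm]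
  split_ifs
  · rw [smul_smul, smul_smul, mul_assoc, one_div_mul_cancel h2, mul_one]
  · simp

theorem projOf_congr {r r' : PauliLabel n} (h : r + r' ∈ B.group i) :
    B.projOf i r = B.projOf i r' := by
  rw [projOf, projOf]
  congr 1
  refine Finset.sum_congr rfl fun p hp => ?_
  rw [mem_groupFinset] at hp
  have h0 := B.symplecticForm_eq_zero i hp h
  rw [symplecticForm_add_right, CharTwo.add_eq_zero] at h0
  rw [h0]

theorem projOf_conjTranspose (r : PauliLabel n) : (B.projOf i r)ᴴ = B.projOf i r := by
  simp [projOf, Matrix.conjTranspose_smul, Matrix.conjTranspose_sum, signedPauli_conjTranspose,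
    star_bitSign, Matrix.conjTranspose_smul]

theorem projOf_trace (r : PauliLabel n) : (B.projOf i r).trace = 1 := by
  have h2 : (2 : ℂ) ^ n ≠ 0 := pow_ne_zero n two_ne_zero
  simp [projOf, Matrix.trace_smul, Matrix.trace_sum, signedPauli_trace, mem_groupFinset,
    symplecticForm_zero_left, bitSign_zero, h2]

theorem pauliString_mul_projOf (p r : PauliLabel n) :
    pauliString p * B.projOf i r = B.projOf i (r + p) * pauliString p := by
  rw [projOf, projOf, Matrix.mul_smul, Matrix.smul_mul, Finset.mul_sum, Finset.sum_mul]
  congr 1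
  refine Finset.sum_congr rfl fun q _ => ?_
  rw [Matrix.mul_smul, pauliString_mul_signedPauli, smul_smul, symplecticForm_add_right,
    bitSign_add, Matrix.smul_mul]

/-- A string that commutes with all strings is in all the groups, so it is the identity. -/
theorem exists_symplecticForm_ne_zero (B : StabilizerCover n) {p : PauliLabel n} (hp : p ≠ 0) :
    ∃ c, symplecticForm p c ≠ 0 := by
  by_contra! h
  have : Nontrivial (Fin (2 ^ n + 1)) :=
    Fin.nontrivial_iff_two_le.mpr (by have := Nat.one_le_two_pow (n := n); omega)
  obtain ⟨i, i', hne⟩ := exists_pair_ne (Fin (2 ^ n + 1))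
  have h1 : p ∈ B.group i ⊓ B.group i' :=
    ⟨(B.mem_group_iff i p).mpr fun _ _ => h _, (B.mem_group_iff i' p).mpr fun _ _ => h _⟩
  rw [B.group_inter i i' hne] at h1
  exact hp h1

/-- The numbering of the cosets by their representatives. -/
noncomputable def cosetEquiv : Fin (2 ^ n) ≃ PauliLabel n ⧸ B.group i :=
  Equiv.ofBijective _ (B.rep_bijective i)

theorem cosetEquiv_eq_mk_iff (j : Fin (2 ^ n)) (r : PauliLabel n) :
    B.cosetEquiv i j = (r : PauliLabel n ⧸ B.group i) ↔ B.rep i j + r ∈ B.group i := by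
  rw [cosetEquiv, Equiv.ofBijective_apply, QuotientAddGroup.eq, pauliLabel_neg]

open Classical in
theorem sum_rep_bitSign {p : PauliLabel n} (hp : p ∈ B.group i) :
    ∑ j, bitSign (symplecticForm p (B.rep i j)) = if p = 0 then 2 ^ n else 0 := by
  split_ifs with h
  · simp [h, symplecticForm_zero_left, bitSign_zero]
  · obtain ⟨c, hc⟩ := B.exists_symplecticForm_ne_zero h
    let σ : Fin (2 ^ n) ≃ Fin (2 ^ n) := (B.cosetEquiv i).trans
      ((Equiv.addRight (c : PauliLabel n ⧸ B.group i)).trans (B.cosetEquiv i).symm)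
    have h1 : ∀ j, bitSign (symplecticForm p (B.rep i (σ j))) =
        -bitSign (symplecticForm p (B.rep i j)) := by
      intro j
      have h2 : B.cosetEquiv i (σ j) =
          ((B.rep i j + c : PauliLabel n) : PauliLabel n ⧸ B.group i) := by
        simp only [σ, Equiv.trans_apply, Equiv.apply_symm_apply, Equiv.coe_addRight]
        rfl
      rw [cosetEquiv_eq_mk_iff] at h2
      have h3 := B.symplecticForm_eq_zero i hp h2
      rw [symplecticForm_add_right, CharTwo.add_eq_zero] at h3
      rw [h3, symplecticForm_add_right, bitSign_add]
      nth_rewrite 2 [bitSign]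
      rw [if_neg hc, mul_neg_one]
    have h2 := Equiv.sum_comp σ fun j => bitSign (symplecticForm p (B.rep i j))
    simp only [h1, Finset.sum_neg_distrib] at h2
    linear_combination (-1 / 2) * h2

theorem sum_projOf_rep : ∑ j, B.projOf i (B.rep i j) = 1 := by
  classical
  have h2 : (2 : ℂ) ^ n ≠ 0 := pow_ne_zero n two_ne_zero
  simp only [projOf, ← Finset.smul_sum]
  rw [Finset.sum_comm, Finset.sum_congr rfl (g := fun p =>
    (if p = 0 then (2 : ℂ) ^ n else 0) • B.signedPauli i p)]
  · simp [mem_groupFinset, signedPauli_zero, smul_smul, h2]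
  · intro p hp
    rw [← Finset.sum_smul, B.sum_rep_bitSign i ((B.mem_groupFinset i p).mp hp)]

/-- Compressions by a stabilizer projector are scalar: the projector has rank one. -/
theorem exists_projOf_mul_mul_projOf (r : PauliLabel n) (A : QubitOp n) :
    ∃ c : ℂ, B.projOf i r * A * B.projOf i r = c • B.projOf i r := by
  classical
  have hP : ∀ p : PauliLabel n,
      ∃ c : ℂ, B.projOf i r * pauliString p * B.projOf i r = c • B.projOf i r := by
    intro p
    have hs : pauliString p = ((B.sign i p : ℤ) : ℂ) • B.signedPauli i p := by
      rw [signedPauli, smul_smul]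
      rcases Int.units_eq_one_or (B.sign i p) with h1 | h1 <;> simp [h1]
    by_cases hp : p ∈ B.group i
    · refine ⟨((B.sign i p : ℤ) : ℂ) * bitSign (symplecticForm p r), ?_⟩
      rw [mul_assoc, pauliString_mul_projOf,
        B.projOf_congr i (r := r + p) (r' := r) (by
          rwa [add_right_comm, pauliLabel_add_self, zero_add]),
        ← mul_assoc, projOf_mul, if_pos (by rw [pauliLabel_add_self]; exact (B.group i).zero_mem),
        hs, Matrix.mul_smul, mul_smul]
      congr 1
      rw [projOf, Matrix.smul_mul, smul_comm]
      congr 1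
      conv_rhs =>
        rw [← B.sum_groupFinset_add i hp fun q => bitSign (symplecticForm q r) • B.signedPauli i q]
      rw [Finset.sum_mul, Finset.smul_sum]
      refine Finset.sum_congr rfl fun q hq => ?_
      rw [mem_groupFinset] at hq
      rw [Matrix.smul_mul, B.signedPauli_mul i hq hp, smul_smul, symplecticForm_add_left,
        bitSign_add, ← mul_assoc, bitSign_mul_self, one_mul, add_comm]
    · refine ⟨0, ?_⟩
      rw [mul_assoc, pauliString_mul_projOf, ← mul_assoc, projOf_mul, if_neg]
      · simp
      · rwa [← add_assoc, pauliLabel_add_self, zero_add]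
  choose c hc using hP
  refine ⟨∑ p, pauliCoeff A p * c p, ?_⟩
  nth_rewrite 1 [← sum_pauliCoeff_smul A]
  rw [Finset.mul_sum, Finset.sum_mul, Finset.sum_smul]
  refine Finset.sum_congr rfl fun p _ => ?_
  rw [Matrix.mul_smul, Matrix.smul_mul, hc, smul_smul]

theorem projOf_mul_self (r : PauliLabel n) : B.projOf i r * B.projOf i r = B.projOf i r := by
  classical
  rw [projOf_mul, if_pos (by rw [pauliLabel_add_self]; exact (B.group i).zero_mem)]

/-- The vector is a normalized column of the projector. -/
theorem exists_vecMulVec_eq_projOf (r : PauliLabel n) :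
    ∃ v : QubitBasis n → ℂ, Matrix.vecMulVec v (star v) = B.projOf i r := by
  classical
  set Q := B.projOf i r with hQ
  obtain ⟨a, ha⟩ : ∃ a, Q a a ≠ 0 := by
    by_contra! h
    have h1 := B.projOf_trace i r
    rw [← hQ, Matrix.trace, Finset.sum_eq_zero fun a _ => (Matrix.diag_apply Q a).trans (h a)] at h1
    exact zero_ne_one h1
  have hstar : ∀ x y, star (Q x y) = Q y x := fun x y => by
    rw [← Matrix.conjTranspose_apply, hQ, projOf_conjTranspose]
  obtain ⟨c, hc⟩ := B.exists_projOf_mul_mul_projOf i r (Matrix.single a a 1)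
  rw [← hQ] at hc
  have hc' : ∀ x y, Q x a * Q a y = c * Q x y := by
    intro x y
    have h1 := congrFun (congrFun hc x) y
    rw [mul_assoc, Matrix.mul_apply, Matrix.smul_apply, smul_eq_mul] at h1
    rw [← h1, Finset.sum_eq_single a]
    · rw [Matrix.single_mul_apply_same, one_mul]
    · intro b _ hb
      rw [Matrix.single_mul_apply_of_ne _ _ _ _ _ hb, mul_zero]
    · simp
  have hca : c = Q a a := (mul_right_cancel₀ ha (hc' a a)).symm
  have hre : Q a a = ((∑ b, ‖Q a b‖ ^ 2 : ℝ) : ℂ) := by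
    conv_lhs => rw [hQ, ← projOf_mul_self, ← hQ, Matrix.mul_apply]
    push_cast
    refine Finset.sum_congr rfl fun b _ => ?_
    rw [← hstar a b]
    exact Complex.mul_conj' _
  set s : ℝ := ∑ b, ‖Q a b‖ ^ 2
  have hs : 0 ≤ s := by positivity
  have hs0 : ((√s : ℝ) : ℂ) * (√s : ℝ) = Q a a := by
    rw [hre, ← Complex.ofReal_mul, Real.mul_self_sqrt hs]
  have hs1 : ((√s : ℝ) : ℂ) ≠ 0 := fun h => ha (by rw [← hs0, h, zero_mul])
  refine ⟨fun x => Q x a / (√s : ℝ), ?_⟩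
  ext x y
  simp only [Matrix.vecMulVec_apply, Pi.star_apply, star_div₀, hstar]
  rw [show star ((√s : ℝ) : ℂ) = (√s : ℝ) from Complex.conj_ofReal _, div_mul_div_comm, hs0,
    hc', hca, mul_div_cancel_left₀ _ ha]

theorem vecMulVec_ket (j : Fin (2 ^ n)) :
    Matrix.vecMulVec (B.ket i j) (star (B.ket i j)) = B.projOf i (B.rep i j) := by
  rw [← proj_eq_projOf]
  refine Classical.epsilon_spec (p := fun v => Matrix.vecMulVec v (star v) = B.proj i j) ?_
  rw [proj_eq_projOf]
  exact B.exists_vecMulVec_eq_projOf i _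

open Classical in
theorem norm_ket_pauliString_ket_sq (P : PauliLabel n) (j l : Fin (2 ^ n)) :
    ‖star (B.ket i j) ⬝ᵥ (pauliString P *ᵥ B.ket i l)‖ ^ 2 =
      if B.rep i j + B.rep i l + P ∈ B.group i then 1 else 0 := by
  set φ := B.ket i j
  set ψ := B.ket i l
  have h1 : (B.projOf i (B.rep i j) * (pauliString P * B.projOf i (B.rep i l) *
      pauliString P)).trace =
      ((‖star φ ⬝ᵥ (pauliString P *ᵥ ψ)‖ ^ 2 : ℝ) : ℂ) := by
    rw [← vecMulVec_ket, ← vecMulVec_ket, Matrix.mul_vecMulVec,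
      Matrix.vecMulVec_mul (pauliString P *ᵥ B.ket i l), Matrix.vecMulVec_mul_vecMulVec,
      Matrix.trace_vecMulVec]
    push_cast
    rw [← Complex.mul_conj']
    rw [dotProduct_smul, smul_eq_mul]
    congr 1
    rw [← Complex.star_def, Matrix.star_dotProduct, Matrix.star_mulVec, pauliString_conjTranspose,
      dotProduct_comm]
    simp [φ, ψ]
  rw [pauliString_mul_projOf, mul_assoc, pauliString_mul_self, mul_one, projOf_mul,
    ← add_assoc] at h1
  split_ifs at h1 ⊢
  · rw [projOf_trace] at h1
    exact_mod_cast h1.symm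
  · rw [Matrix.trace_zero] at h1
    exact_mod_cast h1.symm

/-- Two states of one basis are equivalent iff a string of `S ∪ {I}` maps one coset to the
other. -/
theorem pauliEquivalent_ket_iff (S : Set (PauliLabel n)) (j l : Fin (2 ^ n)) :
    PauliEquivalent S (B.ket i j) (B.ket i l) ↔
      ∃ P ∈ S ∪ {0}, B.rep i j + B.rep i l + P ∈ B.group i := by
  classical
  refine exists_congr fun P => and_congr_right fun _ => ?_
  have h := B.norm_ket_pauliString_ket_sq i P j l
  split_ifs at h with hm
  · simpa [hm] using (pow_eq_one_iff_of_nonneg (norm_nonneg _) two_ne_zero).mp h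
  · simp only [hm, iff_false]
    intro h1
    rw [h1] at h
    norm_num at h

end StabilizerCover

/-! ### Existence of stabilizer covers -/

/-- Commuting Pauli strings have a common eigenvector, with eigenvalues `±1`. -/
theorem exists_common_eigenvector {n : ℕ} (s : Finset (PauliLabel n))
    (hs : ∀ p ∈ s, ∀ q ∈ s, Commute (pauliString p) (pauliString q)) :
    ∃ v : QubitBasis n → ℂ, v ≠ 0 ∧
      ∀ p ∈ s, ∃ e : ℤˣ, pauliString p *ᵥ v = ((e : ℤ) : ℂ) • v := by
  classical
  induction s using Finset.induction_on with
  | empty => exact ⟨1, one_ne_zero, by simp⟩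
  | insert p s hp ih =>
    obtain ⟨v, hv, hev⟩ := ih fun q hq r hr =>
      hs q (Finset.mem_insert_of_mem hq) r (Finset.mem_insert_of_mem hr)
    -- Either `v + P v` is fixed by `P`, or `v` is an eigenvector of `P` with eigenvalue `-1`.
    by_cases hw : v + pauliString p *ᵥ v = 0
    · refine ⟨v, hv, fun q hq => ?_⟩
      rcases Finset.mem_insert.mp hq with rfl | hq
      · exact ⟨-1, by simpa using (neg_eq_of_add_eq_zero_right hw).symm⟩
      · exact hev q hq
    · refine ⟨_, hw, fun q hq => ?_⟩
      rcases Finset.mem_insert.mp hq with rfl | hq'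
      · refine ⟨1, ?_⟩
        rw [Matrix.mulVec_add, Matrix.mulVec_mulVec, pauliString_mul_self, Matrix.one_mulVec]
        simp [add_comm]
      · obtain ⟨e, he⟩ := hev q hq'
        refine ⟨e, ?_⟩
        rw [Matrix.mulVec_add, Matrix.mulVec_mulVec,
          (hs q hq p (Finset.mem_insert_self p s)).eq, ← Matrix.mulVec_mulVec, he,
          Matrix.mulVec_smul, smul_add]

/-- A commuting group of Pauli strings modulo phases lifts to a group of signed Pauli strings: the
signs are the eigenvalues on a common eigenvector. -/
theorem exists_sign_mul {n : ℕ} (G : AddSubgroup (PauliLabel n))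
    (hG : ∀ p ∈ G, ∀ q ∈ G, Commute (pauliString p) (pauliString q)) :
    ∃ sign : PauliLabel n → ℤˣ, ∀ g ∈ G, ∀ h ∈ G,
      (((sign g : ℤ) : ℂ) • pauliString g) * (((sign h : ℤ) : ℂ) • pauliString h) =
        ((sign (g + h) : ℤ) : ℂ) • pauliString (g + h) := by
  classical
  obtain ⟨v, hv, hev⟩ := exists_common_eigenvector (Finset.univ.filter fun p => p ∈ G)
    (by simpa using fun p hp q hq => hG p hp q hq)
  have hev' : ∀ p, ∃ e : ℤˣ, p ∈ G → pauliString p *ᵥ v = ((e : ℤ) : ℂ) • v := by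
    intro p
    by_cases hp : p ∈ G
    · obtain ⟨e, he⟩ := hev p (by simp [hp])
      exact ⟨e, fun _ => he⟩
    · exact ⟨1, fun h => absurd h hp⟩
  choose e he using hev'
  refine ⟨e, fun g hg h hh => ?_⟩
  obtain ⟨c, hc⟩ := pauliString_mul_eq_smul g h
  have h1 : (c * ((e (g + h) : ℤ) : ℂ)) • v = (((e h : ℤ) : ℂ) * ((e g : ℤ) : ℂ)) • v := by
    rw [mul_smul, ← he _ (G.add_mem hg hh), ← Matrix.smul_mulVec, ← hc, ← Matrix.mulVec_mulVec,
      he h hh, Matrix.mulVec_smul, he g hg, smul_smul]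
  have h2 : c * ((e (g + h) : ℤ) : ℂ) = ((e h : ℤ) : ℂ) * ((e g : ℤ) : ℂ) :=
    smul_left_injective ℂ hv h1
  have hsq : ∀ u : ℤˣ, ((u : ℤ) : ℂ) * ((u : ℤ) : ℂ) = 1 := fun u => by
    rcases Int.units_eq_one_or u with rfl | rfl <;> simp
  rw [Matrix.smul_mul, Matrix.mul_smul, hc, smul_smul, smul_smul]
  congr 1
  have h3 : ((e g : ℤ) : ℂ) * ((e h : ℤ) : ℂ) = c * ((e (g + h) : ℤ) : ℂ) := by rw [h2, mul_comm]
  have hc2 : c * c = 1 := by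
    linear_combination (c * ((e (g + h) : ℤ) : ℂ) + ((e h : ℤ) : ℂ) * ((e g : ℤ) : ℂ)) * h2 -
      c * c * hsq (e (g + h)) + ((e h : ℤ) : ℂ) * ((e h : ℤ) : ℂ) * hsq (e g) + hsq (e h)
  rw [h3]
  linear_combination ((e (g + h) : ℤ) : ℂ) * hc2

/-- The identification of `F × F` with Pauli strings, for a field `F` with `2 ^ n` elements: the
`x` bits of `(a, c)` are the coordinates of `a`, and its `z` bits are the coordinates of the
linear functional `tr (c ·)`. It turns `tr (a c' + c a')` into the symplectic form. -/
noncomputable def fieldPauli {n : ℕ} {F : Type*} [Field F] [Algebra (ZMod 2) F]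
    (b : Module.Basis (Fin n) (ZMod 2) F) : F × F →+ PauliLabel n where
  toFun x q := (b.repr x.1 q, Algebra.trace (ZMod 2) F (x.2 * b q))
  map_zero' := by
    funext q
    simp
  map_add' x y := by
    funext q
    simp [add_mul]

theorem trace_eq_sum_repr {n : ℕ} {F : Type*} [Field F] [Algebra (ZMod 2) F]
    (b : Module.Basis (Fin n) (ZMod 2) F) (a c : F) :
    Algebra.trace (ZMod 2) F (c * a) =
      ∑ q, b.repr a q * Algebra.trace (ZMod 2) F (c * b q) := by
  conv_lhs => rw [← b.sum_repr a, Finset.mul_sum, map_sum]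
  refine Finset.sum_congr rfl fun q _ => ?_
  rw [mul_smul_comm, map_smul, smul_eq_mul]

theorem symplecticForm_fieldPauli {n : ℕ} {F : Type*} [Field F] [Algebra (ZMod 2) F]
    (b : Module.Basis (Fin n) (ZMod 2) F) (x y : F × F) :
    symplecticForm (fieldPauli b x) (fieldPauli b y) =
      Algebra.trace (ZMod 2) F (x.1 * y.2 + x.2 * y.1) := by
  rw [map_add, mul_comm x.1, trace_eq_sum_repr b x.1 y.2, trace_eq_sum_repr b y.1 x.2,
    ← Finset.sum_add_distrib]
  refine Finset.sum_congr rfl fun q _ => ?_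
  simp only [fieldPauli, AddMonoidHom.coe_mk, ZeroHom.coe_mk]
  ring

theorem eq_zero_of_trace_mul_eq_zero {F : Type*} [Field F] [Finite F] [Algebra (ZMod 2) F] {c : F}
    (h : ∀ y, Algebra.trace (ZMod 2) F (c * y) = 0) : c = 0 := by
  have : FiniteDimensional (ZMod 2) F := Module.Finite.of_finite
  exact (traceForm_nondegenerate (ZMod 2) F).1 c h

theorem fieldPauli_injective {n : ℕ} {F : Type*} [Field F] [Finite F] [Algebra (ZMod 2) F]
    (b : Module.Basis (Fin n) (ZMod 2) F) : Function.Injective (fieldPauli b) := by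
  rw [injective_iff_map_eq_zero]
  intro x hx
  have h1 : ∀ y, symplecticForm (fieldPauli b x) (fieldPauli b y) = 0 := fun y => by
    rw [hx, symplecticForm_zero_left]
  simp only [symplecticForm_fieldPauli] at h1
  refine Prod.ext ?_ ?_
  · exact eq_zero_of_trace_mul_eq_zero fun y => by simpa using h1 (0, y)
  · exact eq_zero_of_trace_mul_eq_zero fun y => by simpa using h1 (y, 0)

theorem card_field_of_basis {n : ℕ} {F : Type*} [Field F] [Algebra (ZMod 2) F]
    (b : Module.Basis (Fin n) (ZMod 2) F) : Nat.card F = 2 ^ n := by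
  rw [Nat.card_congr b.equivFun.toEquiv]
  simp

theorem fieldPauli_surjective {n : ℕ} {F : Type*} [Field F] [Finite F] [Algebra (ZMod 2) F]
    (b : Module.Basis (Fin n) (ZMod 2) F) : Function.Surjective (fieldPauli b) := by
  refine ((Nat.bijective_iff_injective_and_card _).mpr ⟨fieldPauli_injective b, ?_⟩).2
  rw [Nat.card_prod, card_field_of_basis b]
  simp [← mul_pow]

/-- The lines through the origin of `F × F`, parametrized by `F`: the line of slope `l`, and the
vertical line. -/
def fieldLine {F : Type*} [Field F] : Option F → F →+ F × F
  | some l => (AddMonoidHom.id F).prod (AddMonoidHom.mulLeft l)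
  | none => AddMonoidHom.inr F F

theorem fieldLine_injective {F : Type*} [Field F] (o : Option F) :
    Function.Injective (fieldLine o) := by
  intro x y h
  cases o with
  | none => exact congrArg Prod.snd h
  | some l => exact congrArg Prod.fst h

theorem mem_range_fieldLine_some {F : Type*} [Field F] (l : F) (x : F × F) :
    x ∈ Set.range (fieldLine (some l)) ↔ x.2 = l * x.1 := by
  constructor
  · rintro ⟨y, rfl⟩; rfl
  · intro h; exact ⟨x.1, Prod.ext rfl h.symm⟩

theorem mem_range_fieldLine_none {F : Type*} [Field F] (x : F × F) :
    x ∈ Set.range (fieldLine (none : Option F)) ↔ x.1 = 0 := by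
  constructor
  · rintro ⟨y, rfl⟩; rfl
  · intro h; exact ⟨x.2, Prod.ext h.symm rfl⟩

/-- Every line is its own orthogonal complement under the trace form. -/
theorem mem_range_fieldLine_iff_trace {F : Type*} [Field F] [Finite F] [Algebra (ZMod 2) F]
    (o : Option F) (x : F × F) :
    (∀ y, Algebra.trace (ZMod 2) F (x.1 * (fieldLine o y).2 + x.2 * (fieldLine o y).1) = 0) ↔
      x ∈ Set.range (fieldLine o) := by
  have : CharP F 2 := charP_of_injective_algebraMap (algebraMap (ZMod 2) F).injective 2
  cases o with
  | none =>
    rw [mem_range_fieldLine_none]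
    constructor
    · intro h
      refine eq_zero_of_trace_mul_eq_zero fun y => ?_
      have := h y
      simpa [fieldLine] using this
    · intro h y
      simp [fieldLine, h]
  | some l =>
    rw [mem_range_fieldLine_some]
    have e : ∀ y, x.1 * (fieldLine (some l) y).2 + x.2 * (fieldLine (some l) y).1 =
        (l * x.1 + x.2) * y := fun y => by
      simp only [fieldLine, AddMonoidHom.prod_apply, AddMonoidHom.id_apply,
        AddMonoidHom.coe_mulLeft]
      ring
    simp only [e]
    constructor
    · intro h
      exact (CharTwo.add_eq_zero.mp (eq_zero_of_trace_mul_eq_zero h)).symm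
    · intro h y
      rw [h, CharTwo.add_self_eq_zero, zero_mul, map_zero]

theorem eq_zero_of_mem_range_fieldLine {F : Type*} [Field F] {o o' : Option F} (h : o ≠ o')
    {x : F × F} (hx : x ∈ Set.range (fieldLine o)) (hx' : x ∈ Set.range (fieldLine o')) :
    x = 0 := by
  have key : x.1 = 0 ∧ x.2 = 0 := by
    rcases o with _ | l <;> rcases o' with _ | l'
    · exact absurd rfl h
    · rw [mem_range_fieldLine_none] at hx
      rw [mem_range_fieldLine_some] at hx'
      simp [hx, hx']
    · rw [mem_range_fieldLine_some] at hx
      rw [mem_range_fieldLine_none] at hx'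
      simp [hx, hx']
    · rw [mem_range_fieldLine_some] at hx hx'
      have hl : l - l' ≠ 0 := sub_ne_zero.mpr fun e => h (by rw [e])
      have h1 : (l - l') * x.1 = 0 := by rw [sub_mul, ← hx, ← hx', sub_self]
      have h2 : x.1 = 0 := (mul_eq_zero.mp h1).resolve_left hl
      simp [hx, h2]
  exact Prod.ext key.1 key.2

theorem exists_mem_range_fieldLine {F : Type*} [Field F] (x : F × F) :
    ∃ o, x ∈ Set.range (fieldLine o) := by
  by_cases h : x.1 = 0
  · exact ⟨none, (mem_range_fieldLine_none x).mpr h⟩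
  · exact ⟨some (x.2 / x.1), (mem_range_fieldLine_some _ x).mpr (div_mul_cancel₀ _ h).symm⟩

theorem closure_range_basis {n : ℕ} {F : Type*} [Field F] [Algebra (ZMod 2) F]
    (b : Module.Basis (Fin n) (ZMod 2) F) : AddSubgroup.closure (Set.range b) = ⊤ := by
  have h : (⊤ : Submodule (ZMod 2) F) ≤
      AddSubgroup.toZModSubmodule 2 (AddSubgroup.closure (Set.range b)) := by
    rw [← b.span_eq, Submodule.span_le]
    exact AddSubgroup.subset_closure
  exact top_le_iff.mp fun x _ => h (Submodule.mem_top (x := x))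

theorem nonempty_stabilizerCover {n : ℕ} (hn : n ≠ 0) : Nonempty (StabilizerCover n) := by
  classical
  have hfin : Finite (GaloisField 2 n) :=
    Nat.finite_of_card_ne_zero (by rw [GaloisField.card 2 n hn]; positivity)
  let F := GaloisField 2 n
  have : Fintype F := Fintype.ofFinite F
  have b : Module.Basis (Fin n) (ZMod 2) F := by
    have h := Module.finBasis (ZMod 2) F
    rwa [GaloisField.finrank 2 hn] at h
  have hF : Fintype.card F = 2 ^ n := by
    rw [← Nat.card_eq_fintype_card, card_field_of_basis b]
  let idx : Fin (2 ^ n + 1) ≃ Option F :=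
    (Fintype.equivFinOfCardEq (by rw [Fintype.card_option, hF])).symm
  let line : Fin (2 ^ n + 1) → F →+ PauliLabel n := fun i =>
    (fieldPauli b).comp (fieldLine (idx i))
  have hmem : ∀ i x, fieldPauli b x ∈ (line i).range ↔ x ∈ Set.range (fieldLine (idx i)) := by
    intro i x
    constructor
    · rintro ⟨y, hy⟩; exact ⟨y, fieldPauli_injective b hy⟩
    · rintro ⟨y, rfl⟩; exact ⟨y, rfl⟩
  have hcent : ∀ i g, (∀ h ∈ (line i).range, Commute (pauliString g) (pauliString h)) ↔
      g ∈ (line i).range := by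
    intro i g
    obtain ⟨x, rfl⟩ := fieldPauli_surjective b g
    rw [hmem, ← mem_range_fieldLine_iff_trace]
    simp [commute_pauliString_iff, line, symplecticForm_fieldPauli]
  have hcard : ∀ i, Nat.card (line i).range = 2 ^ n := by
    intro i
    rw [← card_field_of_basis b]
    have hinj : Function.Injective (line i) :=
      (fieldPauli_injective b).comp (fieldLine_injective (idx i))
    exact (Nat.card_congr (AddMonoidHom.ofInjective hinj).toEquiv).symm
  choose sign hsign using fun i => exists_sign_mul (line i).range fun p hp q hq =>
    (hcent i p).mpr hp q hq
  have hquot : ∀ i, Nat.card (PauliLabel n ⧸ (line i).range) = 2 ^ n := by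
    intro i
    have h := (line i).range.card_eq_card_quotient_mul_card_addSubgroup
    rw [hcard] at h
    have h4 : Nat.card (PauliLabel n) = 2 ^ n * 2 ^ n := by simp [← mul_pow]
    rw [h4] at h
    exact (Nat.eq_of_mul_eq_mul_right (by positivity) h).symm
  let e : ∀ i, Fin (2 ^ n) ≃ PauliLabel n ⧸ (line i).range := fun i =>
    (Finite.equivFinOfCardEq (hquot i)).symm
  exact ⟨{
    group := fun i => (line i).range
    card_group := hcard
    centralizer_group := hcent
    group_inter := by
      intro i i' hne
      rw [eq_bot_iff]
      rintro g ⟨h1, h2⟩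
      obtain ⟨x, rfl⟩ := fieldPauli_surjective b g
      have hx := eq_zero_of_mem_range_fieldLine (idx.injective.ne hne) ((hmem i x).mp h1)
        ((hmem i' x).mp h2)
      rw [hx, map_zero]
      exact AddSubgroup.zero_mem _
    group_cover := by
      intro g
      obtain ⟨x, rfl⟩ := fieldPauli_surjective b g
      obtain ⟨o, ho⟩ := exists_mem_range_fieldLine x
      exact ⟨idx.symm o, (hmem _ x).mpr (by rwa [Equiv.apply_symm_apply])⟩
    sign := sign
    sign_mul := hsign
    gen := fun i m => line i (b m)
    closure_gen := by
      intro i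
      rw [show (Set.range fun m => line i (b m)) = line i '' Set.range b from
        Set.range_comp (line i) b, ← AddMonoidHom.map_closure, closure_range_basis b,
        AddMonoidHom.range_eq_map]
    rep := fun i j => (e i j).out
    rep_bijective := by
      intro i
      have : (fun j => (QuotientAddGroup.mk (e i j).out : PauliLabel n ⧸ (line i).range)) = e i :=
        funext fun j => QuotientAddGroup.out_eq' _
      rw [this]
      exact (e i).bijective }⟩

/-! ### The decision program -/

namespace RamProgram

/-- Loop rule: an invariant of the body, with a bound `c` on the steps of each execution. -/
theorem run_loop_spec (I : ℕ → MachineState → Prop) {x : ℕ} {p : RamProgram} {c : ℕ}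
    {s : MachineState} (h0 : I 0 s)
    (hstep : ∀ k < s.reg x, ∀ s', I k s' → I (k + 1) (p.run s').1 ∧ (p.run s').2 ≤ c) :
    I (s.reg x) ((loop x p).run s).1 ∧ ((loop x p).run s).2 ≤ 1 + s.reg x * (c + 1) := by
  have key : ∀ k ≤ s.reg x,
      I k ((fun r : MachineState × ℕ => ((p.run r.1).1, r.2 + (p.run r.1).2 + 1))^[k] (s, 1)).1 ∧
      ((fun r : MachineState × ℕ => ((p.run r.1).1, r.2 + (p.run r.1).2 + 1))^[k] (s, 1)).2 ≤
        1 + k * (c + 1) := by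
    intro k
    induction k with
    | zero => intro _; simpa using h0
    | succ k ih =>
      intro hk
      obtain ⟨h1, h2⟩ := ih (by omega)
      rw [Function.iterate_succ_apply']
      obtain ⟨h3, h4⟩ := hstep k (by omega) _ h1
      refine ⟨h3, ?_⟩
      dsimp only
      rw [Nat.succ_mul]
      omega
  exact key _ le_rfl

theorem run_seq_fst (p q : RamProgram) (s : MachineState) :
    ((seq p q).run s).1 = (q.run (p.run s).1).1 := rfl

theorem run_seq_snd (p q : RamProgram) (s : MachineState) :
    ((seq p q).run s).2 = (p.run s).2 + (q.run (p.run s).1).2 := rfl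

/-- Writes to an otherwise unused register. -/
def skip : RamProgram := const 15 0

/-- Flips the bit in register `7`. -/
def flipBit : RamProgram := ifZero 7 (const 7 1) (const 7 0)

/-- Reads the bits `(x, z)` of one qubit at the address in register `a`, advances that address,
and adds their symplectic product with the bits in registers `10`, `11` to register `7`. -/
def addQubitForm (a : ℕ) : RamProgram :=
  seq (load 12 a) <| seq (succ a) <| seq (ifZero 12 skip (ifZero 11 skip flipBit)) <|
  seq (load 12 a) <| seq (succ a) (ifZero 12 skip (ifZero 10 skip flipBit))

/-- Reads the bits of one qubit of the generator at the address in register `4` into registers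
`10` and `11`, and advances that address. -/
def loadQubit : RamProgram :=
  seq (load 10 4) <| seq (succ 4) <| seq (load 11 4) (succ 4)

/-- One qubit of a commutation test: the address of the generator is in register `4`, and those
of the three strings that are multiplied are in registers `5`, `2`, `3`. -/
def qubitStep : RamProgram :=
  seq loadQubit <| seq (addQubitForm 5) <| seq (addQubitForm 2) (addQubitForm 3)

/-- One commutation test; a violation is recorded in register `8`. -/
def generatorStep : RamProgram :=
  seq (const 7 0) <| seq (const 2 0) <| seq (copy 3 14) <| seq (copy 5 6) <|
  seq (loop 0 qubitStep) (ifZero 7 skip (const 8 1))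

/-- Adds `2 n` to register `a`. -/
def addTwoN (a : ℕ) : RamProgram := loop 0 (seq (succ a) (succ a))

/-- The test of the string at the address in register `6` against all generators; a success is
recorded in register `9`. The address advances to the next string. -/
def stringStep : RamProgram :=
  seq (const 8 0) <| seq (copy 4 13) <| seq (loop 0 generatorStep) <|
  seq (ifZero 8 (const 9 1) skip) (addTwoN 6)

/-- Computes the addresses of the second representative (register `14`), of the first generator
(register `13`) and of the first string (register `6`). -/
def addressSetup : RamProgram :=
  seq (addTwoN 14) <| seq (copy 13 14) <| seq (addTwoN 13) <| seq (copy 6 13)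
    (loop 0 (addTwoN 6))

/-- The program that decides `∼_S`. It runs once more than the list is long: the memory beyond
the input is zero and is read as the identity string. -/
def pauliEquivalenceProgram : RamProgram :=
  seq addressSetup <| seq (succ 1) <| seq (loop 1 stringStep) (copy 0 9)

theorem bit_cases (w : ZMod 2) : w = 0 ∨ w = 1 := by revert w; decide

theorem run_flip_spec (s : MachineState) (r : ℕ) (x u w : ZMod 2) (h7 : s.reg 7 = w.val)
    (hr : s.reg r = u.val) (h12 : s.reg 12 = x.val) :
    let R := (ifZero 12 skip (ifZero r skip flipBit)).run s
    R.1.mem = s.mem ∧ R.1.reg 7 = (w + x * u).val ∧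
      (∀ y, y ≠ 7 → y ≠ 15 → R.1.reg y = s.reg y) ∧ R.2 ≤ 4 := by
  rcases bit_cases w with rfl | rfl <;> rcases bit_cases x with rfl | rfl <;>
    rcases bit_cases u with rfl | rfl <;>
    simp_all [run, skip, flipBit, CharTwo.add_self_eq_zero, ZMod.val_one]

theorem run_addQubitForm_spec (M : ℕ → ZMod 2) (s : MachineState) (a : ℕ) (u v w : ZMod 2)
    (ha : a ≠ 7 ∧ a ≠ 10 ∧ a ≠ 11 ∧ a ≠ 12 ∧ a ≠ 15)
    (hM : s.mem = fun x => (M x).val) (h7 : s.reg 7 = w.val)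
    (h10 : s.reg 10 = u.val) (h11 : s.reg 11 = v.val) :
    let R := (addQubitForm a).run s
    R.1.mem = s.mem ∧ R.1.reg a = s.reg a + 2 ∧
      R.1.reg 7 = (w + M (s.reg a) * v + M (s.reg a + 1) * u).val ∧
      (∀ y, y ≠ a → y ≠ 7 → y ≠ 12 → y ≠ 15 → R.1.reg y = s.reg y) ∧ R.2 ≤ 12 := by
  obtain ⟨ha7, ha10, ha11, ha12, ha15⟩ := ha
  intro R
  let s1 := ((seq (load 12 a) (succ a)).run s).1
  have hs1 : s1.mem = s.mem ∧ s1.reg a = s.reg a + 1 ∧ s1.reg 12 = (M (s.reg a)).val ∧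
      ∀ y, y ≠ a → y ≠ 12 → s1.reg y = s.reg y := by
    refine ⟨rfl, ?_, ?_, ?_⟩
    · simp [s1, run, ha12]
    · simp [s1, run, Ne.symm ha12, hM]
    · intro y h1 h2
      simp [s1, run, h1, h2]
  obtain ⟨m1, a1, x1, f1⟩ := hs1
  obtain ⟨m2, w2, f2, t2⟩ := run_flip_spec s1 11 (M (s.reg a)) v w
    (by rw [f1 7 (Ne.symm ha7) (by norm_num), h7])
    (by rw [f1 11 (Ne.symm ha11) (by norm_num), h11]) x1
  set s2 := ((ifZero 12 skip (ifZero 11 skip flipBit)).run s1).1 with hs2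
  have a2 : s2.reg a = s.reg a + 1 := by rw [f2 a ha7 ha15, a1]
  let s3 := ((seq (load 12 a) (succ a)).run s2).1
  have hs3 : s3.mem = s.mem ∧ s3.reg a = s.reg a + 2 ∧ s3.reg 12 = (M (s.reg a + 1)).val ∧
      ∀ y, y ≠ a → y ≠ 12 → s3.reg y = s2.reg y := by
    refine ⟨?_, ?_, ?_, ?_⟩
    · rw [← m1, ← m2]; rfl
    · simp [s3, run, ha12, a2]
    · simp [s3, run, Ne.symm ha12, a2, m2, m1, hM]
    · intro y h1 h2
      simp [s3, run, h1, h2]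
  obtain ⟨m3, a3, x3, f3⟩ := hs3
  obtain ⟨m4, w4, f4, t4⟩ := run_flip_spec s3 10 (M (s.reg a + 1)) u (w + M (s.reg a) * v)
    (by rw [f3 7 (Ne.symm ha7) (by norm_num), w2])
    (by rw [f3 10 (Ne.symm ha10) (by norm_num), f2 10 (by norm_num) (by norm_num),
      f1 10 (Ne.symm ha10) (by norm_num), h10]) x3
  set s4 := ((ifZero 12 skip (ifZero 10 skip flipBit)).run s3).1 with hs4
  have hR : R.1 = s4 := rfl
  have hT : R.2 = 1 + (1 + (((ifZero 12 skip (ifZero 11 skip flipBit)).run s1).2 +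
    (1 + (1 + ((ifZero 12 skip (ifZero 10 skip flipBit)).run s3).2)))) := rfl
  refine ⟨?_, ?_, ?_, ?_, ?_⟩
  · rw [hR, m4, m3]
  · rw [hR, f4 a ha7 ha15, a3]
  · rw [hR, w4]
  · intro y h1 h2 h3 h4
    rw [hR, f4 y h2 h4, f3 y h1 h3, f2 y h2 h4, f1 y h1 h3]
  · rw [hT]; omega

/-- The contribution of one qubit to the symplectic product of the string at address `g` with the
product of the strings at `a`, `b` and `c`. -/
def qubitTerm (M : ℕ → ZMod 2) (a b c g : ℕ) : ZMod 2 :=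
  (M a + M b + M c) * M (g + 1) + (M (a + 1) + M (b + 1) + M (c + 1)) * M g

theorem run_loadQubit_spec (M : ℕ → ZMod 2) (s : MachineState)
    (hM : s.mem = fun x => (M x).val) :
    let R := loadQubit.run s
    R.1.mem = s.mem ∧ R.1.reg 4 = s.reg 4 + 2 ∧ R.1.reg 10 = (M (s.reg 4)).val ∧
      R.1.reg 11 = (M (s.reg 4 + 1)).val ∧
      (∀ y, y ≠ 4 → y ≠ 10 → y ≠ 11 → R.1.reg y = s.reg y) ∧ R.2 = 4 := by
  refine ⟨rfl, ?_, ?_, ?_, ?_, rfl⟩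
  · simp [loadQubit, run]
  · simp [loadQubit, run, hM]
  · simp [loadQubit, run, hM]
  · intro y h1 h2 h3
    simp [loadQubit, run, h1, h2, h3]

theorem run_qubitStep_spec (M : ℕ → ZMod 2) (s : MachineState) (w : ZMod 2)
    (hM : s.mem = fun x => (M x).val) (h7 : s.reg 7 = w.val) :
    let R := qubitStep.run s
    R.1.mem = s.mem ∧ R.1.reg 2 = s.reg 2 + 2 ∧ R.1.reg 3 = s.reg 3 + 2 ∧
      R.1.reg 4 = s.reg 4 + 2 ∧ R.1.reg 5 = s.reg 5 + 2 ∧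
      R.1.reg 7 = (w + qubitTerm M (s.reg 5) (s.reg 2) (s.reg 3) (s.reg 4)).val ∧
      (∀ y, y ∉ ({2, 3, 4, 5, 7, 10, 11, 12, 15} : Finset ℕ) → R.1.reg y = s.reg y) ∧
      R.2 ≤ 40 := by
  intro R
  obtain ⟨m1, g1, u1, v1, f1, t1⟩ := run_loadQubit_spec M s hM
  generalize hs1 : (loadQubit.run s).1 = s1 at m1 g1 u1 v1 f1
  obtain ⟨m2, a2, w2, f2, t2⟩ := run_addQubitForm_spec M s1 5 _ _ w (by norm_num)
    (by rw [m1, hM]) (by rw [f1 7 (by norm_num) (by norm_num) (by norm_num), h7]) u1 v1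
  generalize hs2 : ((addQubitForm 5).run s1).1 = s2 at m2 a2 w2 f2
  obtain ⟨m3, a3, w3, f3, t3⟩ := run_addQubitForm_spec M s2 2 (M (s.reg 4)) (M (s.reg 4 + 1)) _
    (by norm_num) (by rw [m2, m1, hM]) w2
    (by rw [f2 10 (by norm_num) (by norm_num) (by norm_num) (by norm_num), u1])
    (by rw [f2 11 (by norm_num) (by norm_num) (by norm_num) (by norm_num), v1])
  generalize hs3 : ((addQubitForm 2).run s2).1 = s3 at m3 a3 w3 f3
  obtain ⟨m4, a4, w4, f4, t4⟩ := run_addQubitForm_spec M s3 3 (M (s.reg 4)) (M (s.reg 4 + 1)) _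
    (by norm_num) (by rw [m3, m2, m1, hM]) w3
    (by rw [f3 10 (by norm_num) (by norm_num) (by norm_num) (by norm_num),
      f2 10 (by norm_num) (by norm_num) (by norm_num) (by norm_num), u1])
    (by rw [f3 11 (by norm_num) (by norm_num) (by norm_num) (by norm_num),
      f2 11 (by norm_num) (by norm_num) (by norm_num) (by norm_num), v1])
  generalize hs4 : ((addQubitForm 3).run s3).1 = s4 at m4 a4 w4 f4
  have hR : R.1 = s4 := by
    simp only [R, qubitStep, run_seq_fst, hs1, hs2, hs3, hs4]
  have hT : R.2 = (loadQubit.run s).2 + (((addQubitForm 5).run s1).2 +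
      (((addQubitForm 2).run s2).2 + ((addQubitForm 3).run s3).2)) := by
    simp only [R, qubitStep, run_seq_snd, hs1, hs2, hs3]
  have e5 : s1.reg 5 = s.reg 5 := f1 5 (by norm_num) (by norm_num) (by norm_num)
  have e2 : s2.reg 2 = s.reg 2 := by
    rw [f2 2 (by norm_num) (by norm_num) (by norm_num) (by norm_num),
      f1 2 (by norm_num) (by norm_num) (by norm_num)]
  have e3 : s3.reg 3 = s.reg 3 := by
    rw [f3 3 (by norm_num) (by norm_num) (by norm_num) (by norm_num),
      f2 3 (by norm_num) (by norm_num) (by norm_num) (by norm_num),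
      f1 3 (by norm_num) (by norm_num) (by norm_num)]
  refine ⟨?_, ?_, ?_, ?_, ?_, ?_, ?_, ?_⟩
  · rw [hR, m4, m3, m2, m1]
  · rw [hR, f4 2 (by norm_num) (by norm_num) (by norm_num) (by norm_num), a3, e2]
  · rw [hR, a4, e3]
  · rw [hR, f4 4 (by norm_num) (by norm_num) (by norm_num) (by norm_num),
      f3 4 (by norm_num) (by norm_num) (by norm_num) (by norm_num),
      f2 4 (by norm_num) (by norm_num) (by norm_num) (by norm_num), g1]
  · rw [hR, f4 5 (by norm_num) (by norm_num) (by norm_num) (by norm_num),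
      f3 5 (by norm_num) (by norm_num) (by norm_num) (by norm_num), a2, e5]
  · rw [hR, w4, e3, e2, e5]
    refine congrArg ZMod.val ?_
    rw [qubitTerm]
    ring
  · intro y hy
    simp only [Finset.mem_insert, Finset.mem_singleton, not_or] at hy
    obtain ⟨h2, h3, h4, h5, h7', h10, h11, h12, h15⟩ := hy
    rw [hR, f4 y h3 h7' h12 h15, f3 y h2 h7' h12 h15, f2 y h5 h7' h12 h15, f1 y h4 h10 h11]
  · rw [hT, t1]
    generalize ((addQubitForm 5).run s1).2 = k2 at t2
    generalize ((addQubitForm 2).run s2).2 = k3 at t3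
    generalize ((addQubitForm 3).run s3).2 = k4 at t4
    omega

theorem run_addTwoN_spec (a : ℕ) (s : MachineState) :
    let R := (addTwoN a).run s
    R.1.mem = s.mem ∧ R.1.reg a = s.reg a + 2 * s.reg 0 ∧
      (∀ y, y ≠ a → R.1.reg y = s.reg y) ∧ R.2 ≤ 1 + s.reg 0 * 3 := by
  have h := run_loop_spec (fun k s' => s'.mem = s.mem ∧ s'.reg a = s.reg a + 2 * k ∧
      ∀ y, y ≠ a → s'.reg y = s.reg y) (x := 0) (p := seq (succ a) (succ a)) (c := 2) (s := s)
    ⟨rfl, rfl, fun _ _ => rfl⟩ ?_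
  · exact ⟨h.1.1, h.1.2.1, h.1.2.2, h.2⟩
  · rintro k _ s' ⟨h1, h2, h3⟩
    refine ⟨⟨h1, ?_, ?_⟩, le_rfl⟩
    · simp [run, h2]; ring
    · intro y hy
      simp [run, hy, h3 y hy]

theorem run_addressSetup_spec (s : MachineState) (hreg : ∀ x, x ≠ 0 → x ≠ 1 → s.reg x = 0) :
    let R := addressSetup.run s
    R.1.mem = s.mem ∧ R.1.reg 14 = 2 * s.reg 0 ∧ R.1.reg 13 = 4 * s.reg 0 ∧
      R.1.reg 6 = 4 * s.reg 0 + 2 * s.reg 0 * s.reg 0 ∧ R.1.reg 0 = s.reg 0 ∧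
      R.1.reg 1 = s.reg 1 ∧ R.1.reg 9 = 0 ∧
      R.2 ≤ 5 + 8 * s.reg 0 + 3 * (s.reg 0 * s.reg 0) := by
  intro R
  obtain ⟨m1, a1, f1, t1⟩ := run_addTwoN_spec 14 s
  set s1 := ((addTwoN 14).run s).1 with hs1
  let s2 := ((copy 13 14).run s1).1
  have f2 : ∀ y, y ≠ 13 → s2.reg y = s1.reg y := fun y hy => by simp [s2, run, hy]
  have a2 : s2.reg 13 = s1.reg 14 := by simp [s2, run]
  obtain ⟨m3, a3, f3, t3⟩ := run_addTwoN_spec 13 s2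
  set s3 := ((addTwoN 13).run s2).1 with hs3
  let s4 := ((copy 6 13).run s3).1
  have f4 : ∀ y, y ≠ 6 → s4.reg y = s3.reg y := fun y hy => by simp [s4, run, hy]
  have a4 : s4.reg 6 = s3.reg 13 := by simp [s4, run]
  have n1 : s1.reg 0 = s.reg 0 := f1 0 (by norm_num)
  have n2 : s2.reg 0 = s.reg 0 := (f2 0 (by norm_num)).trans n1
  have n4 : s4.reg 0 = s.reg 0 := by rw [f4 0 (by norm_num), f3 0 (by norm_num), n2]
  rw [hreg 14 (by norm_num) (by norm_num)] at a1
  have h13 : s3.reg 13 = 4 * s.reg 0 := by rw [a3, a2, a1, n2]; ring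
  have h := run_loop_spec (fun k s' => s'.mem = s4.mem ∧ s'.reg 6 = s4.reg 6 + 2 * s.reg 0 * k ∧
      ∀ y, y ≠ 6 → s'.reg y = s4.reg y) (x := 0) (p := addTwoN 6) (c := 1 + s.reg 0 * 3) (s := s4)
    ⟨rfl, rfl, fun _ _ => rfl⟩ ?_
  · rw [n4] at h
    obtain ⟨⟨m5, a5, f5⟩, t5⟩ := h
    have hR : R.1 = ((loop 0 (addTwoN 6)).run s4).1 := rfl
    have hT : R.2 = ((addTwoN 14).run s).2 + (1 + (((addTwoN 13).run s2).2 + (1 +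
      ((loop 0 (addTwoN 6)).run s4).2))) := rfl
    refine ⟨?_, ?_, ?_, ?_, ?_, ?_, ?_, ?_⟩
    · rw [hR, m5]; exact m3.trans m1
    · rw [hR, f5 14 (by norm_num), f4 14 (by norm_num), f3 14 (by norm_num), f2 14 (by norm_num),
        a1, zero_add]
    · rw [hR, f5 13 (by norm_num), f4 13 (by norm_num), h13]
    · rw [hR, a5, a4, h13]
    · rw [hR, f5 0 (by norm_num), n4]
    · rw [hR, f5 1 (by norm_num), f4 1 (by norm_num), f3 1 (by norm_num), f2 1 (by norm_num),
        f1 1 (by norm_num)]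
    · rw [hR, f5 9 (by norm_num), f4 9 (by norm_num), f3 9 (by norm_num), f2 9 (by norm_num),
        f1 9 (by norm_num), hreg 9 (by norm_num) (by norm_num)]
    · rw [hT]
      rw [n2] at t3
      have : s.reg 0 * (1 + s.reg 0 * 3 + 1) = 2 * s.reg 0 + 3 * (s.reg 0 * s.reg 0) := by ring
      omega
  · rintro k _ s' ⟨h1, h2, h3⟩
    obtain ⟨m5, a5, f5, t5⟩ := run_addTwoN_spec 6 s'
    have n5 : s'.reg 0 = s.reg 0 := by rw [h3 0 (by norm_num), n4]
    rw [n5] at a5 t5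
    refine ⟨⟨m5.trans h1, ?_, ?_⟩, t5⟩
    · rw [a5, h2]; ring
    · intro y hy
      rw [f5 y hy, h3 y hy]

end RamProgram

namespace RamProgram

/-- The symplectic product, over the first `q` qubits, of the string at address `g` with the
product of the string at address `a` and the two strings at the beginning of the memory. -/
def addressForm (M : ℕ → ZMod 2) (n a g q : ℕ) : ZMod 2 :=
  ∑ k ∈ Finset.range q, qubitTerm M (a + 2 * k) (2 * k) (2 * n + 2 * k) (g + 2 * k)

theorem run_generatorStep_spec (M : ℕ → ZMod 2) (s : MachineState)
    (hM : s.mem = fun x => (M x).val) (h14 : s.reg 14 = 2 * s.reg 0) :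
    let R := generatorStep.run s
    R.1.mem = s.mem ∧ R.1.reg 4 = s.reg 4 + 2 * s.reg 0 ∧
      R.1.reg 8 = (if addressForm M (s.reg 0) (s.reg 6) (s.reg 4) (s.reg 0) = 0
        then s.reg 8 else 1) ∧
      (∀ y ∈ ({0, 1, 6, 9, 13, 14} : Finset ℕ), R.1.reg y = s.reg y) ∧
      R.2 ≤ 7 + 41 * s.reg 0 := by
  intro R
  have hinit : ∀ s1, s1 =
      ((seq (const 7 0) <| seq (const 2 0) <| seq (copy 3 14) (copy 5 6)).run s).1 →
      s1.mem = s.mem ∧ s1.reg 7 = 0 ∧ s1.reg 2 = 0 ∧ s1.reg 3 = s.reg 14 ∧ s1.reg 5 = s.reg 6 ∧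
      ∀ y, y ≠ 7 → y ≠ 2 → y ≠ 3 → y ≠ 5 → s1.reg y = s.reg y := by
    rintro s1 rfl
    refine ⟨rfl, ?_, ?_, ?_, ?_, ?_⟩
    · simp [run]
    · simp [run]
    · simp [run]
    · simp [run]
    · intro y h1 h2 h3 h4
      simp [run, h1, h2, h3, h4]
  generalize hs1 : ((seq (const 7 0) <| seq (const 2 0) <|
    seq (copy 3 14) (copy 5 6)).run s).1 = s1 at hinit
  obtain ⟨m1, z1, p1, q1, b1, f1⟩ := hinit s1 rfl
  have n1 : s1.reg 0 = s.reg 0 := f1 0 (by norm_num) (by norm_num) (by norm_num) (by norm_num)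
  have g1 : s1.reg 4 = s.reg 4 := f1 4 (by norm_num) (by norm_num) (by norm_num) (by norm_num)
  have h := run_loop_spec (fun k s' => s'.mem = s.mem ∧ s'.reg 2 = 2 * k ∧
      s'.reg 3 = 2 * s.reg 0 + 2 * k ∧ s'.reg 4 = s.reg 4 + 2 * k ∧ s'.reg 5 = s.reg 6 + 2 * k ∧
      s'.reg 7 = (addressForm M (s.reg 0) (s.reg 6) (s.reg 4) k).val ∧
      ∀ y, y ∉ ({2, 3, 4, 5, 7, 10, 11, 12, 15} : Finset ℕ) → s'.reg y = s.reg y)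
      (x := 0) (p := qubitStep) (c := 40) (s := s1) ?_ ?_
  · rw [n1] at h
    obtain ⟨⟨m2, -, -, g2, -, w2, f2⟩, t2⟩ := h
    have hR : R.1 = ((ifZero 7 skip (const 8 1)).run ((loop 0 qubitStep).run s1).1).1 := by
      rw [← hs1]; rfl
    have hT : R.2 = 4 + ((loop 0 qubitStep).run s1).2 + 2 := by
      rw [← hs1]
      have h1 : ∀ s', ((ifZero 7 skip (const 8 1)).run s').2 = 2 := by
        intro s'
        simp only [run, skip]
        split_ifs <;> rfl
      simp only [R, generatorStep, run_seq_snd, h1]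
      simp only [run]
      omega
    generalize ((loop 0 qubitStep).run s1).1 = s2 at hR m2 g2 w2 f2
    generalize ((loop 0 qubitStep).run s1).2 = k2 at hT t2
    have hlast : ∀ y, y ≠ 15 → R.1.reg y = if y = 8 ∧ s2.reg 7 ≠ 0 then 1 else s2.reg y := by
      intro y hy
      rw [hR]
      by_cases h7 : s2.reg 7 = 0
      · simp [run, skip, h7, hy]
      · simp [run, h7, Function.update_apply]
    refine ⟨?_, ?_, ?_, ?_, ?_⟩
    · rw [hR, ← m2]
      simp only [run, skip]
      split_ifs <;> rfl
    · rw [hlast 4 (by norm_num), if_neg (by norm_num), g2]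
    · rw [hlast 8 (by norm_num), w2, f2 8 (by decide)]
      simp only [true_and, ne_eq, ZMod.val_eq_zero, ite_not]
    · intro y hy
      have hy' : y ∉ ({2, 3, 4, 5, 7, 10, 11, 12, 15} : Finset ℕ) ∧ y ≠ 8 ∧ y ≠ 15 := by
        revert y; decide
      rw [hlast y hy'.2.2, if_neg (fun h => hy'.2.1 h.1), f2 y hy'.1]
    · rw [hT]; omega
  · refine ⟨m1, p1, by rw [q1, h14]; rfl, g1, b1, by simp [z1, addressForm], ?_⟩
    intro y hy
    simp only [Finset.mem_insert, Finset.mem_singleton, not_or] at hy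
    exact f1 y hy.2.2.2.2.1 hy.1 hy.2.1 hy.2.2.2.1
  · rintro k _ s' ⟨h1, h2, h3, h4, h5, h7, hf⟩
    obtain ⟨m, r2, r3, r4, r5, r7, rf, t⟩ := run_qubitStep_spec M s' _ (h1.trans hM) h7
    refine ⟨⟨m.trans h1, by rw [r2, h2]; ring, by rw [r3, h3]; ring, by rw [r4, h4]; ring,
      by rw [r5, h5]; ring, ?_, fun y hy => (rf y hy).trans (hf y hy)⟩, t⟩
    rw [r7, h2, h3, h4, h5, addressForm, addressForm, Finset.sum_range_succ]

open Classical in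
theorem run_stringStep_spec (M : ℕ → ZMod 2) (s : MachineState)
    (hM : s.mem = fun x => (M x).val) (h13 : s.reg 13 = 4 * s.reg 0)
    (h14 : s.reg 14 = 2 * s.reg 0) :
    let R := stringStep.run s
    R.1.mem = s.mem ∧ R.1.reg 6 = s.reg 6 + 2 * s.reg 0 ∧
      R.1.reg 9 = (if ∀ m < s.reg 0, addressForm M (s.reg 0) (s.reg 6)
        (4 * s.reg 0 + 2 * s.reg 0 * m) (s.reg 0) = 0 then 1 else s.reg 9) ∧
      (∀ y ∈ ({0, 1, 13, 14} : Finset ℕ), R.1.reg y = s.reg y) ∧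
      R.2 ≤ 6 + 11 * s.reg 0 + 41 * (s.reg 0 * s.reg 0) := by
  intro R
  have hinit : ∀ s1, s1 = ((seq (const 8 0) (copy 4 13)).run s).1 →
      s1.mem = s.mem ∧ s1.reg 8 = 0 ∧ s1.reg 4 = s.reg 13 ∧
      ∀ y, y ≠ 8 → y ≠ 4 → s1.reg y = s.reg y := by
    rintro s1 rfl
    refine ⟨rfl, ?_, ?_, ?_⟩
    · simp [run]
    · simp [run]
    · intro y h1 h2
      simp [run, h1, h2]
  generalize hs1 : ((seq (const 8 0) (copy 4 13)).run s).1 = s1 at hinit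
  obtain ⟨m1, z1, g1, f1⟩ := hinit s1 rfl
  have n1 : s1.reg 0 = s.reg 0 := f1 0 (by norm_num) (by norm_num)
  have h := run_loop_spec (fun k s' => s'.mem = s.mem ∧
      s'.reg 4 = 4 * s.reg 0 + 2 * s.reg 0 * k ∧
      s'.reg 8 = (if ∀ m < k, addressForm M (s.reg 0) (s.reg 6)
        (4 * s.reg 0 + 2 * s.reg 0 * m) (s.reg 0) = 0 then 0 else 1) ∧
      ∀ y ∈ ({0, 1, 6, 9, 13, 14} : Finset ℕ), s'.reg y = s.reg y)
      (x := 0) (p := generatorStep) (c := 7 + 41 * s.reg 0) (s := s1) ?_ ?_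
  · rw [n1] at h
    obtain ⟨⟨m2, -, w2, f2⟩, t2⟩ := h
    have hR : R.1 = ((addTwoN 6).run ((ifZero 8 (const 9 1) skip).run
        ((loop 0 generatorStep).run s1).1).1).1 := by
      rw [← hs1]; rfl
    have hT : R.2 = 2 + ((loop 0 generatorStep).run s1).2 + 2 + ((addTwoN 6).run
        ((ifZero 8 (const 9 1) skip).run ((loop 0 generatorStep).run s1).1).1).2 := by
      rw [← hs1]
      have h1 : ∀ s', ((ifZero 8 (const 9 1) skip).run s').2 = 2 := by
        intro s'
        simp only [run, skip]
        split_ifs <;> rfl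
      simp only [R, stringStep, run_seq_snd, h1]
      simp only [run_seq_fst]
      simp only [run]
      omega
    generalize ((loop 0 generatorStep).run s1).1 = s2 at hR hT m2 w2 f2
    generalize ((loop 0 generatorStep).run s1).2 = k2 at hT t2
    have hlast : ∀ s3, s3 = ((ifZero 8 (const 9 1) skip).run s2).1 → s3.mem = s2.mem ∧
        ∀ y, y ≠ 15 → s3.reg y = if y = 9 ∧ s2.reg 8 = 0 then 1 else s2.reg y := by
      rintro s3 rfl
      constructor
      · simp only [run, skip]
        split_ifs <;> rfl
      · intro y hy
        by_cases h7 : s2.reg 8 = 0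
        · simp [run, h7, Function.update_apply]
        · simp [run, skip, h7, hy]
    generalize ((ifZero 8 (const 9 1) skip).run s2).1 = s3 at hR hT hlast
    obtain ⟨m3, f3⟩ := hlast s3 rfl
    obtain ⟨m4, a4, f4, t4⟩ := run_addTwoN_spec 6 s3
    rw [← hR] at m4 a4 f4
    have n3 : s3.reg 0 = s.reg 0 := by
      rw [f3 0 (by norm_num), if_neg (by norm_num), f2 0 (by decide)]
    rw [n3] at a4 t4
    refine ⟨?_, ?_, ?_, ?_, ?_⟩
    · rw [m4, m3, m2]
    · rw [a4, f3 6 (by norm_num), if_neg (by norm_num), f2 6 (by decide)]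
    · rw [f4 9 (by norm_num), f3 9 (by norm_num), w2, f2 9 (by decide)]
      split_ifs <;> simp_all
    · intro y hy
      have hy' : y ∈ ({0, 1, 6, 9, 13, 14} : Finset ℕ) ∧ y ≠ 6 ∧ y ≠ 9 ∧ y ≠ 15 := by
        revert y; decide
      rw [f4 y hy'.2.1, f3 y hy'.2.2.2, if_neg (fun h => hy'.2.2.1 h.1), f2 y hy'.1]
    · rw [hT]
      have e : s.reg 0 * (7 + 41 * s.reg 0 + 1) =
        8 * s.reg 0 + 41 * (s.reg 0 * s.reg 0) := by ring
      omega
  · refine ⟨m1, by rw [g1, h13]; rfl, by simp [z1], ?_⟩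
    intro y hy
    have hy' : y ≠ 8 ∧ y ≠ 4 := by revert y; decide
    exact f1 y hy'.1 hy'.2
  · rintro k _ s' ⟨h1, h4, h8, hf⟩
    have e0 : s'.reg 0 = s.reg 0 := hf 0 (by decide)
    obtain ⟨m, r4, r8, rf, t⟩ := run_generatorStep_spec M s' (h1.trans hM)
      (by rw [hf 14 (by decide), e0, h14])
    rw [e0] at r4 r8 t
    refine ⟨⟨m.trans h1, by rw [r4, h4]; ring, ?_, fun y hy => (rf y hy).trans (hf y hy)⟩, t⟩
    rw [r8, h8, h4, hf 6 (by decide)]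
    simp only [Nat.lt_succ_iff_lt_or_eq, or_imp, forall_and, forall_eq]
    split_ifs <;> simp_all

theorem run_pauliEquivalenceProgram_spec (M : ℕ → ZMod 2) (s : MachineState)
    (hM : s.mem = fun x => (M x).val) (hreg : ∀ x, x ≠ 0 → x ≠ 1 → s.reg x = 0) :
    let R := pauliEquivalenceProgram.run s
    (R.1.reg 0 ≠ 0 ↔ ∃ t < s.reg 1 + 1, ∀ m < s.reg 0, addressForm M (s.reg 0)
      (4 * s.reg 0 + 2 * s.reg 0 * s.reg 0 + 2 * s.reg 0 * t)
      (4 * s.reg 0 + 2 * s.reg 0 * m) (s.reg 0) = 0) ∧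
    R.2 ≤ 15 + 19 * s.reg 0 + 44 * (s.reg 0 * s.reg 0) +
      s.reg 1 * (7 + 11 * s.reg 0 + 41 * (s.reg 0 * s.reg 0)) := by
  classical
  intro R
  obtain ⟨m1, a14, a13, a6, a0, a1, a9, t1⟩ := run_addressSetup_spec s hreg
  have hR0 : R.1 = ((copy 0 9).run ((loop 1 stringStep).run
    ((succ 1).run (addressSetup.run s).1).1).1).1 := rfl
  have hT0 : R.2 = (addressSetup.run s).2 + (1 + (((loop 1 stringStep).run
    ((succ 1).run (addressSetup.run s).1).1).2 + 1)) := rfl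
  generalize (addressSetup.run s).1 = s1 at hR0 hT0 m1 a14 a13 a6 a0 a1 a9
  generalize (addressSetup.run s).2 = k1 at hT0 t1
  have hsucc : ∀ s2, s2 = ((succ 1).run s1).1 → s2.mem = s1.mem ∧ s2.reg 1 = s1.reg 1 + 1 ∧
      ∀ y, y ≠ 1 → s2.reg y = s1.reg y := by
    rintro s2 rfl
    exact ⟨rfl, by simp [run], fun y hy => by simp [run, hy]⟩
  generalize ((succ 1).run s1).1 = s2 at hR0 hT0 hsucc
  obtain ⟨m2, b1, f2⟩ := hsucc s2 rfl
  rw [a1] at b1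
  have h := run_loop_spec (fun k s' => s'.mem = s.mem ∧ s'.reg 0 = s.reg 0 ∧
      s'.reg 13 = 4 * s.reg 0 ∧ s'.reg 14 = 2 * s.reg 0 ∧
      s'.reg 6 = 4 * s.reg 0 + 2 * s.reg 0 * s.reg 0 + 2 * s.reg 0 * k ∧
      (s'.reg 9 ≠ 0 ↔ ∃ t < k, ∀ m < s.reg 0, addressForm M (s.reg 0)
        (4 * s.reg 0 + 2 * s.reg 0 * s.reg 0 + 2 * s.reg 0 * t)
        (4 * s.reg 0 + 2 * s.reg 0 * m) (s.reg 0) = 0))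
      (x := 1) (p := stringStep) (c := 6 + 11 * s.reg 0 + 41 * (s.reg 0 * s.reg 0)) (s := s2) ?_ ?_
  · rw [b1] at h
    obtain ⟨⟨-, -, -, -, -, w⟩, t2⟩ := h
    have hR : R.1.reg 0 = ((loop 1 stringStep).run s2).1.reg 9 := by rw [hR0]; simp [run]
    refine ⟨by rw [hR]; exact w, ?_⟩
    rw [hT0]
    generalize ((loop 1 stringStep).run s2).2 = k2 at t2
    have e : (s.reg 1 + 1) * (6 + 11 * s.reg 0 + 41 * (s.reg 0 * s.reg 0) + 1) =
      7 + 11 * s.reg 0 + 41 * (s.reg 0 * s.reg 0) +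
      s.reg 1 * (7 + 11 * s.reg 0 + 41 * (s.reg 0 * s.reg 0)) := by ring
    omega
  · refine ⟨m2.trans m1, ?_, ?_, ?_, ?_, ?_⟩
    · rw [f2 0 (by norm_num), a0]
    · rw [f2 13 (by norm_num), a13]
    · rw [f2 14 (by norm_num), a14]
    · rw [f2 6 (by norm_num), a6]; rfl
    · rw [f2 9 (by norm_num), a9]; simp
  · rintro k _ s' ⟨h1, h0, h13, h14, h6, h9⟩
    obtain ⟨m, r6, r9, rf, t⟩ := run_stringStep_spec M s' (h1.trans hM) (by rw [h13, h0])
      (by rw [h14, h0])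
    rw [h0] at r6 r9 t
    refine ⟨⟨m.trans h1, (rf 0 (by decide)).trans h0, (rf 13 (by decide)).trans h13,
      (rf 14 (by decide)).trans h14, by rw [r6, h6]; ring, ?_⟩, t⟩
    rw [r9, h6]
    simp only [Nat.lt_succ_iff_lt_or_eq, or_and_right, exists_or, exists_eq_left, ← h9]
    split_ifs with hc
    · exact iff_of_true one_ne_zero (Or.inr hc)
    · simp [hc]

end RamProgram

/-! ### The input of the program -/

theorem getD_flatten_of_length_eq {α : Type*} (d : α) {c : ℕ} (LL : List (List α))
    (h : ∀ l ∈ LL, l.length = c) (t r : ℕ) (hr : r < c) :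
    LL.flatten.getD (c * t + r) d = (LL.getD t []).getD r d := by
  induction LL generalizing t with
  | nil => simp
  | cons l LL ih =>
    have hl : l.length = c := h l (List.mem_cons_self ..)
    rw [List.flatten_cons]
    cases t with
    | zero =>
      rw [List.getD_append _ _ _ _ (by simpa [hl] using hr)]
      simp
    | succ t =>
      rw [List.getD_append_right _ _ _ _ (by rw [hl, mul_add]; omega), hl,
        show c * (t + 1) + r - c = c * t + r by rw [mul_add]; omega,
        ih (fun l' h' => h l' (List.mem_cons_of_mem _ h'))]
      simp

theorem length_flatten_of_length_eq {α : Type*} {c : ℕ} (LL : List (List α))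
    (h : ∀ l ∈ LL, l.length = c) : LL.flatten.length = LL.length * c := by
  induction LL with
  | nil => simp
  | cons l LL ih =>
    rw [List.flatten_cons, List.length_append, h l (List.mem_cons_self ..),
      ih fun l' h' => h l' (List.mem_cons_of_mem _ h'), List.length_cons]
    ring

theorem length_pauliBits {n : ℕ} (P : PauliLabel n) : (pauliBits P).length = 2 * n := by
  rw [pauliBits, length_flatten_of_length_eq (c := 2), List.length_ofFn, mul_comm]
  intro l hl
  obtain ⟨q, rfl⟩ := (List.mem_ofFn' _ _).mp hl
  rfl

theorem pauliBits_getD {n : ℕ} (P : PauliLabel n) (k : Fin n) :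
    (pauliBits P).getD (2 * k) 0 = (P k).1.val ∧
      (pauliBits P).getD (2 * k + 1) 0 = (P k).2.val := by
  have h : ∀ l ∈ List.ofFn fun q => [(P q).1.val, (P q).2.val], l.length = 2 := by
    intro l hl
    obtain ⟨q, rfl⟩ := (List.mem_ofFn' _ _).mp hl
    rfl
  have hk : (List.ofFn fun q => [(P q).1.val, (P q).2.val]).getD k [] =
      [(P k).1.val, (P k).2.val] := by
    rw [List.getD_eq_getElem _ _ (by simp)]
    simp
  constructor
  · have := getD_flatten_of_length_eq 0 _ h k 0 (by norm_num)
    rw [hk] at this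
    exact this
  · have := getD_flatten_of_length_eq 0 _ h k 1 (by norm_num)
    rw [hk] at this
    exact this

theorem pauliBits_zero_getD {n : ℕ} (r : ℕ) : (pauliBits (0 : PauliLabel n)).getD r 0 = 0 := by
  have h : ∀ x ∈ pauliBits (0 : PauliLabel n), x = 0 := by
    intro x hx
    simp only [pauliBits, List.mem_flatten] at hx
    obtain ⟨l, hl, hx⟩ := hx
    obtain ⟨q, rfl⟩ := (List.mem_ofFn' _ _).mp hl
    simpa using hx
  rcases lt_or_ge r (pauliBits (0 : PauliLabel n)).length with hr | hr
  · rw [List.getD_eq_getElem _ _ hr]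
    exact h _ (List.getElem_mem hr)
  · rw [List.getD_eq_default _ _ hr]

namespace StabilizerCover

variable {n : ℕ} (B : StabilizerCover n) (L : List (PauliLabel n)) (i : Fin (2 ^ n + 1))
  (j l : Fin (2 ^ n))

/-- The strings of which the input of the decision program consists. -/
def inputStrings : List (PauliLabel n) :=
  B.rep i j :: B.rep i l :: (List.ofFn (B.gen i) ++ L)

theorem testInput_eq_flatten :
    B.testInput L i j l = ((B.inputStrings L i j l).map pauliBits).flatten := by
  simp [testInput, inputStrings, List.map_ofFn, Function.comp_def]

theorem length_testInput : (B.testInput L i j l).length = (2 + n + L.length) * (2 * n) := by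
  rw [testInput_eq_flatten, length_flatten_of_length_eq (c := 2 * n)]
  · simp only [inputStrings, List.length_map, List.length_cons, List.length_append,
      List.length_ofFn]
    ring
  · intro x hx
    obtain ⟨P, -, rfl⟩ := List.mem_map.mp hx
    exact length_pauliBits P

/-- The input bits at addresses `2 n t` to `2 n (t + 1)` are those of string number `t`; beyond the
input they are those of the identity string. -/
theorem testInput_getD (t r : ℕ) (hr : r < 2 * n) :
    (B.testInput L i j l).getD (2 * n * t + r) 0 =
      (pauliBits ((B.inputStrings L i j l).getD t 0)).getD r 0 := by
  rw [testInput_eq_flatten, getD_flatten_of_length_eq (c := 2 * n)]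
  · rcases lt_or_ge t (B.inputStrings L i j l).length with ht | ht
    · rw [List.getD_eq_getElem _ [] (by simpa using ht),
        List.getD_eq_getElem _ (0 : PauliLabel n) ht, List.getElem_map]
    · rw [List.getD_eq_default _ [] (by simpa using ht),
        List.getD_eq_default _ (0 : PauliLabel n) ht, pauliBits_zero_getD]
      simp
  · intro x hx
    obtain ⟨P, -, rfl⟩ := List.mem_map.mp hx
    exact length_pauliBits P
  · exact hr

/-- The memory of the program, as bits. -/
def inputBit (a : ℕ) : ZMod 2 := ((B.testInput L i j l).getD a 0 : ℕ)

theorem testState_mem :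
    (B.testState L i j l).mem = fun a => (B.inputBit L i j l a).val := by
  funext a
  have h : ∀ x ∈ B.testInput L i j l, x < 2 := by
    intro x hx
    rw [testInput_eq_flatten] at hx
    simp only [List.mem_flatten, List.mem_map] at hx
    obtain ⟨_, ⟨P, -, rfl⟩, hx⟩ := hx
    simp only [pauliBits, List.mem_flatten] at hx
    obtain ⟨_, hl, hx⟩ := hx
    obtain ⟨q, rfl⟩ := (List.mem_ofFn' _ _).mp hl
    simp only [List.mem_cons, List.not_mem_nil, or_false] at hx
    rcases hx with rfl | rfl <;> exact ZMod.val_lt _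
  simp only [testState, inputBit]
  rw [ZMod.val_natCast, Nat.mod_eq_of_lt]
  rcases lt_or_ge a (B.testInput L i j l).length with ha | ha
  · rw [List.getD_eq_getElem _ _ ha]
    exact h _ (List.getElem_mem ha)
  · rw [List.getD_eq_default _ _ ha]
    norm_num

theorem inputBit_eq (t : ℕ) (k : Fin n) :
    B.inputBit L i j l (2 * n * t + 2 * k) = ((B.inputStrings L i j l).getD t 0 k).1 ∧
    B.inputBit L i j l (2 * n * t + 2 * k + 1) = ((B.inputStrings L i j l).getD t 0 k).2 := by
  have hk := k.2
  constructor
  · rw [inputBit, testInput_getD _ _ _ _ _ _ _ (by omega), (pauliBits_getD _ k).1,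
      ZMod.natCast_zmod_val]
  · rw [inputBit, add_assoc, testInput_getD _ _ _ _ _ _ _ (by omega), (pauliBits_getD _ k).2,
      ZMod.natCast_zmod_val]

theorem addressForm_inputBit (t : ℕ) (m : Fin n) :
    RamProgram.addressForm (B.inputBit L i j l) n (4 * n + 2 * n * n + 2 * n * t)
      (4 * n + 2 * n * m) n =
    symplecticForm (B.rep i j + B.rep i l + L.getD t 0) (B.gen i m) := by
  rw [RamProgram.addressForm, Finset.sum_range, symplecticForm]
  refine Finset.sum_congr rfl fun k _ => ?_
  have h0 : (B.inputStrings L i j l).getD 0 0 = B.rep i j := rfl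
  have h1 : (B.inputStrings L i j l).getD 1 0 = B.rep i l := rfl
  have h2 : (B.inputStrings L i j l).getD (2 + m) 0 = B.gen i m := by
    rw [add_comm]
    change (List.ofFn (B.gen i) ++ L).getD m 0 = _
    rw [List.getD_append _ _ _ _ (by simp), List.getD_eq_getElem _ _ (by simp)]
    simp
  have h3 : (B.inputStrings L i j l).getD (2 + n + t) 0 = L.getD t 0 := by
    rw [show 2 + n + t = n + t + 2 by ring]
    change (List.ofFn (B.gen i) ++ L).getD (n + t) 0 = _
    rw [List.getD_append_right _ _ _ _ (by simp)]
    simp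
  obtain ⟨a0, b0⟩ := B.inputBit_eq L i j l 0 k
  obtain ⟨a1, b1⟩ := B.inputBit_eq L i j l 1 k
  obtain ⟨a2, b2⟩ := B.inputBit_eq L i j l (2 + m) k
  obtain ⟨a3, b3⟩ := B.inputBit_eq L i j l (2 + n + t) k
  rw [h0, mul_zero, zero_add] at a0 b0
  rw [h1, mul_one] at a1 b1
  rw [h2, show 2 * n * (2 + m) = 4 * n + 2 * n * m by ring] at a2 b2
  rw [h3, show 2 * n * (2 + n + t) = 4 * n + 2 * n * n + 2 * n * t by ring] at a3 b3
  rw [RamProgram.qubitTerm, a0, b0, a1, b1, a2, b2, a3, b3]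
  simp only [Pi.add_apply, Prod.fst_add, Prod.snd_add]
  ring

/-- Membership in the stabilizer group is tested on the generators. -/
theorem mem_group_iff_gen (g : PauliLabel n) :
    g ∈ B.group i ↔ ∀ m, symplecticForm g (B.gen i m) = 0 := by
  constructor
  · intro hg m
    refine B.symplecticForm_eq_zero i hg ?_
    rw [← B.closure_gen i]
    exact AddSubgroup.subset_closure ⟨m, rfl⟩
  · intro h
    rw [mem_group_iff, ← B.closure_gen i]
    intro x hx
    induction hx using AddSubgroup.closure_induction with
    | mem x hx =>
      obtain ⟨m, rfl⟩ := hx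
      exact h m
    | zero => rw [symplecticForm_comm, symplecticForm_zero_left]
    | add x y _ _ hx hy => rw [symplecticForm_add_right, hx, hy, add_zero]
    | neg x _ hx => rwa [pauliLabel_neg]

theorem testAccepts_iff :
    B.testAccepts RamProgram.pauliEquivalenceProgram L i j l = true ↔
      ∃ P ∈ {P | P ∈ L} ∪ {0}, B.rep i j + B.rep i l + P ∈ B.group i := by
  have h := (RamProgram.run_pauliEquivalenceProgram_spec (B.inputBit L i j l)
    (B.testState L i j l) (B.testState_mem L i j l)
    (fun x h0 h1 => by simp [testState, h0, h1])).1
  have e0 : (B.testState L i j l).reg 0 = n := rfl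
  have e1 : (B.testState L i j l).reg 1 = L.length := rfl
  rw [e0, e1] at h
  rw [testAccepts, bne_iff_ne, h]
  have key : ∀ t, (∀ m < n, RamProgram.addressForm (B.inputBit L i j l) n
      (4 * n + 2 * n * n + 2 * n * t) (4 * n + 2 * n * m) n = 0) ↔
      B.rep i j + B.rep i l + L.getD t 0 ∈ B.group i := by
    intro t
    rw [mem_group_iff_gen]
    constructor
    · intro h m
      rw [← addressForm_inputBit]
      exact h m m.2
    · intro h m hm
      exact (B.addressForm_inputBit L i j l t ⟨m, hm⟩).trans (h ⟨m, hm⟩)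
  simp only [key]
  constructor
  · rintro ⟨t, ht, hg⟩
    refine ⟨_, ?_, hg⟩
    rcases Nat.lt_succ_iff_lt_or_eq.mp ht with ht | rfl
    · left
      rw [List.getD_eq_getElem _ _ ht]
      exact List.getElem_mem ht
    · right
      simp
  · rintro ⟨P, hP | hP, hg⟩
    · obtain ⟨t, ht, rfl⟩ := List.getElem_of_mem hP
      exact ⟨t, by omega, by rwa [List.getD_eq_getElem _ _ ht]⟩
    · rw [Set.mem_singleton_iff] at hP
      subst hP
      exact ⟨L.length, by omega, by simpa using hg⟩

theorem testTime_le : B.testTime RamProgram.pauliEquivalenceProgram L i j l ≤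
    15 + 23 * n + 46 * (n * n) + L.length * (7 + 13 * n + 41 * (n * n)) := by
  have h := (RamProgram.run_pauliEquivalenceProgram_spec (B.inputBit L i j l)
    (B.testState L i j l) (B.testState_mem L i j l)
    (fun x h0 h1 => by simp [testState, h0, h1])).2
  have e0 : (B.testState L i j l).reg 0 = n := rfl
  have e1 : (B.testState L i j l).reg 1 = L.length := rfl
  rw [e0, e1] at h
  rw [testTime, length_testInput]
  refine (Nat.add_le_add_left h _).trans (le_of_eq ?_)
  ring

end StabilizerCover

theorem decidesPauliEquivalence_pauliEquivalenceProgram :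
    DecidesPauliEquivalence RamProgram.pauliEquivalenceProgram := by
  intro n B L i j l
  rw [B.testAccepts_iff, B.pauliEquivalent_ket_iff]

/-! ### The distribution of one experiment -/

/-- The time evolution operator `exp(-itH)`. -/
noncomputable def evolutionOp {n : ℕ} (H : QubitOp n) (t : ℝ) : QubitOp n :=
  NormedSpace.exp ((-(Complex.I * t)) • H)

theorem evolutionOp_conjTranspose {n : ℕ} {H : QubitOp n} (hH : H.IsHermitian) (t : ℝ) :
    (evolutionOp H t)ᴴ = NormedSpace.exp ((Complex.I * t) • H) := by
  rw [evolutionOp, ← Matrix.exp_conjTranspose, Matrix.conjTranspose_smul, hH.eq]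
  congr 2
  simp

theorem evolve_eq {n : ℕ} {H : QubitOp n} (hH : H.IsHermitian) (t : ℝ) (ρ : QubitOp n) :
    evolve H t ρ = evolutionOp H t * ρ * (evolutionOp H t)ᴴ := by
  rw [evolutionOp_conjTranspose hH]
  rfl

theorem evolutionOp_conjTranspose_mul_self {n : ℕ} {H : QubitOp n} (hH : H.IsHermitian) (t : ℝ) :
    (evolutionOp H t)ᴴ * evolutionOp H t = 1 := by
  rw [evolutionOp_conjTranspose hH, evolutionOp, neg_smul,
    ← Matrix.exp_add_of_commute _ _ (Commute.refl ((Complex.I * t) • H)).neg_right, add_neg_cancel,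
    NormedSpace.exp_zero]

/-- For a unitary operator, the squares of the Pauli coefficients are a probability distribution. -/
theorem sum_norm_pauliCoeff_sq {n : ℕ} {U : QubitOp n} (hU : Uᴴ * U = 1) :
    ∑ p, ‖pauliCoeff U p‖ ^ 2 = 1 := by
  have h := trace_conjTranspose_mul_self_eq U
  rw [hU, Matrix.trace_one] at h
  have h2 : (2 : ℝ) ^ n ≠ 0 := pow_ne_zero n two_ne_zero
  have h3 : ((2 ^ n : ℝ) : ℂ) = ((2 ^ n * ∑ p, ‖pauliCoeff U p‖ ^ 2 : ℝ) : ℂ) := by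
    rw [← h]
    simp
  have h4 := Complex.ofReal_injective h3
  exact (mul_left_cancel₀ h2 ((mul_one _).trans h4)).symm

namespace StabilizerCover

variable {n : ℕ} (B : StabilizerCover n) (i : Fin (2 ^ n + 1))

/-- Applying `U` to a stabilizer state and weighting the outcomes of the measurement by a function
`f` of the coset of the displacement amounts to weighting the Pauli expansion of `U` by `f`. -/
theorem sum_smul_projOf_mul_mul_projOf (U : QubitOp n) (f : PauliLabel n → ℂ)
    (hf : ∀ r r', r + r' ∈ B.group i → f r = f r') (r : PauliLabel n) :
    ∑ l, f (r + B.rep i l) • (B.projOf i (B.rep i l) * U * B.projOf i r) =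
      (∑ p, (pauliCoeff U p * f p) • pauliString p) * B.projOf i r := by
  classical
  have hone : ∀ p : PauliLabel n, ∑ l, f (r + B.rep i l) •
      (B.projOf i (B.rep i l) * pauliString p * B.projOf i r) =
      f p • (pauliString p * B.projOf i r) := by
    intro p
    have hiff : ∀ l, B.rep i l + (r + p) ∈ B.group i ↔
        l = (B.cosetEquiv i).symm ((r + p : PauliLabel n) : PauliLabel n ⧸ B.group i) := by
      intro l
      rw [← cosetEquiv_eq_mk_iff, Equiv.eq_symm_apply]
    have hterm : ∀ l, f (r + B.rep i l) •
        (B.projOf i (B.rep i l) * pauliString p * B.projOf i r) =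
        if l = (B.cosetEquiv i).symm ((r + p : PauliLabel n) : PauliLabel n ⧸ B.group i)
        then f p • (pauliString p * B.projOf i r) else 0 := by
      intro l
      rw [mul_assoc, pauliString_mul_projOf, ← mul_assoc, projOf_mul]
      simp only [← hiff]
      split_ifs with h
      · rw [hf (r + B.rep i l) p (by rwa [add_comm r, add_assoc])]
      · simp
    rw [Finset.sum_congr rfl fun l _ => hterm l, Finset.sum_ite_eq', if_pos (Finset.mem_univ _)]
  calc ∑ l, f (r + B.rep i l) • (B.projOf i (B.rep i l) * U * B.projOf i r)
      = ∑ l, ∑ p, pauliCoeff U p • f (r + B.rep i l) •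
          (B.projOf i (B.rep i l) * pauliString p * B.projOf i r) := by
        refine Finset.sum_congr rfl fun l _ => ?_
        nth_rewrite 1 [← sum_pauliCoeff_smul U]
        rw [Finset.mul_sum, Finset.sum_mul, Finset.smul_sum]
        refine Finset.sum_congr rfl fun p _ => ?_
        rw [Matrix.mul_smul, Matrix.smul_mul, smul_comm]
    _ = ∑ p, pauliCoeff U p • f p • (pauliString p * B.projOf i r) := by
        rw [Finset.sum_comm]
        refine Finset.sum_congr rfl fun p _ => ?_
        rw [← Finset.smul_sum, hone]
    _ = _ := by
        rw [Finset.sum_mul]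
        refine Finset.sum_congr rfl fun p _ => ?_
        rw [Matrix.smul_mul, smul_smul]

/-- The probability of the transition from state `j` to state `l` under `U`. -/
noncomputable def transition (U : QubitOp n) (j l : Fin (2 ^ n)) : ℝ :=
  (B.projOf i (B.rep i l) * (U * B.projOf i (B.rep i j) * Uᴴ)).trace.re

theorem trace_eq_transition (U : QubitOp n) (j l : Fin (2 ^ n)) :
    (B.projOf i (B.rep i l) * (U * B.projOf i (B.rep i j) * Uᴴ)).trace =
      (B.transition i U j l : ℂ) ∧ 0 ≤ B.transition i U j l := by
  have h : (B.projOf i (B.rep i l) * (U * B.projOf i (B.rep i j) * Uᴴ)).trace =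
      ((B.projOf i (B.rep i j) * Uᴴ * B.projOf i (B.rep i l))ᴴ *
        (B.projOf i (B.rep i j) * Uᴴ * B.projOf i (B.rep i l))).trace := by
    rw [Matrix.conjTranspose_mul, Matrix.conjTranspose_mul, projOf_conjTranspose,
      projOf_conjTranspose, Matrix.conjTranspose_conjTranspose]
    calc (B.projOf i (B.rep i l) * (U * B.projOf i (B.rep i j) * Uᴴ)).trace
        = (B.projOf i (B.rep i l) * B.projOf i (B.rep i l) *
            (U * (B.projOf i (B.rep i j) * B.projOf i (B.rep i j)) * Uᴴ)).trace := by
          rw [projOf_mul_self, projOf_mul_self]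
      _ = _ := by
          rw [mul_assoc, Matrix.trace_mul_comm (B.projOf i (B.rep i l))]
          refine congrArg Matrix.trace ?_
          simp only [mul_assoc]
  have h2 := h.trans (trace_conjTranspose_mul_self_eq _)
  refine ⟨?_, ?_⟩
  · rw [transition, h2, Complex.ofReal_re]
  · rw [transition, h2, Complex.ofReal_re]
    positivity

theorem sum_transition {U : QubitOp n} (hU : Uᴴ * U = 1) (j : Fin (2 ^ n)) :
    ∑ l, B.transition i U j l = 1 := by
  simp only [transition]
  rw [← Complex.re_sum, ← Matrix.trace_sum, ← Finset.sum_mul, sum_projOf_rep, one_mul,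
    Matrix.trace_mul_comm, ← mul_assoc, hU, one_mul, projOf_trace, Complex.one_re]

/-- The displacement of a random state of basis `i` under `U` is distributed like the coset of a
random Pauli string with distribution `‖pauliCoeff U p‖ ^ 2`. -/
theorem sum_transition_of_coset (U : QubitOp n) (A : PauliLabel n → Prop) [DecidablePred A]
    (hA : ∀ r r', r + r' ∈ B.group i → (A r ↔ A r')) :
    ∑ j, ∑ l, (if A (B.rep i j + B.rep i l) then B.transition i U j l else 0) =
      2 ^ n * ∑ p, if A p then ‖pauliCoeff U p‖ ^ 2 else 0 := by
  let f : PauliLabel n → ℂ := fun r => if A r then 1 else 0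
  have hf : ∀ r r', r + r' ∈ B.group i → f r = f r' := by
    intro r r' h
    simp only [f, hA r r' h]
  have h1 : ∑ j, ∑ l, f (B.rep i j + B.rep i l) *
      (B.projOf i (B.rep i l) * (U * B.projOf i (B.rep i j) * Uᴴ)).trace =
      2 ^ n * ∑ p, (pauliCoeff U p * f p) * star (pauliCoeff U p) := by
    calc _ = ∑ j, ((∑ p, (pauliCoeff U p * f p) • pauliString p) *
          B.projOf i (B.rep i j) * Uᴴ).trace := by
          refine Finset.sum_congr rfl fun j _ => ?_
          rw [← B.sum_smul_projOf_mul_mul_projOf i U f hf, Finset.sum_mul, Matrix.trace_sum]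
          refine Finset.sum_congr rfl fun l _ => ?_
          rw [Matrix.smul_mul, Matrix.trace_smul, smul_eq_mul, mul_assoc, mul_assoc, mul_assoc]
      _ = ((∑ p, (pauliCoeff U p * f p) • pauliString p) * Uᴴ).trace := by
          rw [← Matrix.trace_sum, ← Finset.sum_mul, ← Finset.mul_sum, sum_projOf_rep, mul_one]
      _ = _ := by
          rw [trace_mul_conjTranspose_eq_sum]
          simp only [pauliCoeff_sum_smul]
  apply Complex.ofReal_injective
  push_cast
  convert h1 using 1
  · refine Finset.sum_congr rfl fun j _ => Finset.sum_congr rfl fun l _ => ?_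
    rw [(B.trace_eq_transition i U j l).1]
    simp only [f]
    split_ifs <;> simp
  · congr 1
    refine Finset.sum_congr rfl fun p _ => ?_
    simp only [f]
    split_ifs
    · rw [mul_one]
      push_cast
      exact (Complex.mul_conj' _).symm
    · simp

open Classical in
theorem experiment_toOuterMeasure {H : QubitOp n} (hH : H.IsHermitian) (t : ℝ)
    (A : Fin (2 ^ n + 1) → PauliLabel n → Prop)
    (hA : ∀ i r r', r + r' ∈ B.group i → (A i r ↔ A i r')) :
    (B.experiment H t).toOuterMeasure
        {x | A x.1 (B.rep x.1 x.2.1 + B.rep x.1 x.2.2)} =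
      ENNReal.ofReal ((2 ^ n + 1 : ℝ)⁻¹ *
        ∑ i, ∑ p, if A i p then ‖pauliCoeff (evolutionOp H t) p‖ ^ 2 else 0) := by
  set U := evolutionOp H t with hUdef
  have hU : Uᴴ * U = 1 := evolutionOp_conjTranspose_mul_self hH t
  have hborn : ∀ i j l, bornPMF (B.proj i) (evolve H t (B.proj i j)) l =
      ENNReal.ofReal (B.transition i U j l) := by
    intro i j l
    have h1 : ∀ l, ENNReal.ofReal (B.proj i l * evolve H t (B.proj i j)).trace.re =
        ENNReal.ofReal (B.transition i U j l) := by
      intro l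
      rw [evolve_eq hH, proj_eq_projOf, proj_eq_projOf]
      rfl
    have h2 : ∑ l, ENNReal.ofReal (B.proj i l * evolve H t (B.proj i j)).trace.re = 1 := by
      simp only [h1]
      rw [← ENNReal.ofReal_sum_of_nonneg fun l _ => (B.trace_eq_transition i U j l).2,
        B.sum_transition i hU, ENNReal.ofReal_one]
    rw [bornPMF, dif_pos h2, PMF.ofFintype_apply, h1]
  have hnn : ∀ i j l, 0 ≤ (if A i (B.rep i j + B.rep i l) then B.transition i U j l else 0) := by
    intro i j l
    split_ifs
    · exact (B.trace_eq_transition i U j l).2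
    · exact le_rfl
  have hw : ∀ i, 0 ≤ ∑ p, if A i p then ‖pauliCoeff U p‖ ^ 2 else 0 := fun i =>
    Finset.sum_nonneg fun p _ => by split_ifs <;> positivity
  have hi : ∀ i, ((PMF.uniformOfFintype (Fin (2 ^ n))).bind fun j =>
      (bornPMF (B.proj i) (evolve H t (B.proj i j))).map fun l => (i, j, l)).toOuterMeasure
        {x | A x.1 (B.rep x.1 x.2.1 + B.rep x.1 x.2.2)} =
      ENNReal.ofReal (∑ p, if A i p then ‖pauliCoeff U p‖ ^ 2 else 0) := by
    intro i
    rw [PMF.toOuterMeasure_bind_apply, tsum_fintype]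
    have hj : ∀ j, ((bornPMF (B.proj i) (evolve H t (B.proj i j))).map
        fun l => (i, j, l)).toOuterMeasure {x | A x.1 (B.rep x.1 x.2.1 + B.rep x.1 x.2.2)} =
        ENNReal.ofReal (∑ l, if A i (B.rep i j + B.rep i l) then B.transition i U j l else 0) := by
      intro j
      rw [PMF.toOuterMeasure_map_apply, PMF.toOuterMeasure_apply_fintype,
        ENNReal.ofReal_sum_of_nonneg fun l _ => hnn i j l]
      refine Finset.sum_congr rfl fun l _ => ?_
      simp only [Set.indicator_apply, Set.mem_preimage, Set.mem_ofPred_eq, hborn]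
      split_ifs <;> simp
    simp only [hj, PMF.uniformOfFintype_apply, Fintype.card_fin]
    rw [← Finset.mul_sum, ← ENNReal.ofReal_sum_of_nonneg fun j _ =>
      Finset.sum_nonneg fun l _ => hnn i j l, B.sum_transition_of_coset i U (A i) (hA i),
      ENNReal.ofReal_mul (by positivity), ← mul_assoc]
    have h2 : ((2 ^ n : ℕ) : ENNReal) = ENNReal.ofReal (2 ^ n) := by
      rw [← ENNReal.ofReal_natCast]; norm_num
    rw [h2, ENNReal.inv_mul_cancel (by simp) ENNReal.ofReal_ne_top, one_mul]
  rw [experiment, PMF.toOuterMeasure_bind_apply, tsum_fintype]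
  simp only [hi, PMF.uniformOfFintype_apply, Fintype.card_fin]
  rw [← Finset.mul_sum, ← ENNReal.ofReal_sum_of_nonneg fun i _ => hw i,
    ENNReal.ofReal_mul (by positivity), ENNReal.ofReal_inv_of_pos (by positivity)]
  congr 2
  rw [← ENNReal.ofReal_natCast]
  norm_num

end StabilizerCover

/-! ### First-order expansion of the evolution -/

theorem pauliCoeff_sub {n : ℕ} (A B : QubitOp n) (p : PauliLabel n) :
    pauliCoeff (A - B) p = pauliCoeff A p - pauliCoeff B p := by
  simp only [pauliCoeff, sub_mul, Matrix.trace_sub, sub_div]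

theorem pauliCoeff_smul {n : ℕ} (c : ℂ) (A : QubitOp n) (p : PauliLabel n) :
    pauliCoeff (c • A) p = c * pauliCoeff A p := by
  simp only [pauliCoeff, Matrix.smul_mul, Matrix.trace_smul, smul_eq_mul, mul_div_assoc]

theorem pauliCoeff_one_of_ne_zero {n : ℕ} {p : PauliLabel n} (hp : p ≠ 0) :
    pauliCoeff (1 : QubitOp n) p = 0 := by
  simp [pauliCoeff, pauliString_trace, hp]

theorem star_pauliCoeff {n : ℕ} {H : QubitOp n} (hH : H.IsHermitian) (p : PauliLabel n) :
    star (pauliCoeff H p) = pauliCoeff H p := by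
  rw [pauliCoeff, star_div₀, ← Matrix.trace_conjTranspose, Matrix.conjTranspose_mul, hH.eq,
    pauliString_conjTranspose, Matrix.trace_mul_comm]
  simp

theorem abs_eigenvalues_le_opNorm {n : ℕ} {H : QubitOp n} (hH : H.IsHermitian)
    (a : QubitBasis n) : |hH.eigenvalues a| ≤ opNorm H := by
  have h1 : Matrix.toEuclideanCLM (𝕜 := ℂ) H (hH.eigenvectorBasis a) =
      (hH.eigenvalues a) • hH.eigenvectorBasis a := by
    apply (WithLp.ofLp_injective 2)
    rw [Matrix.ofLp_toEuclideanCLM, hH.mulVec_eigenvectorBasis]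
    rfl
  have h2 := (Matrix.toEuclideanCLM (𝕜 := ℂ) H).le_opNorm (hH.eigenvectorBasis a)
  rw [h1, norm_smul, hH.eigenvectorBasis.orthonormal.1 a, mul_one, mul_one] at h2
  exact h2

/-- The remainder of the first-order expansion of `exp(-itH)`. -/
noncomputable def evolutionRemainder {n : ℕ} (H : QubitOp n) (t : ℝ) : QubitOp n :=
  evolutionOp H t - 1 - (-(Complex.I * t)) • H

theorem trace_evolutionRemainder_le {n : ℕ} {H : QubitOp n} (hH : H.IsHermitian)
    (hop : opNorm H ≤ 1) {t : ℝ} (ht0 : 0 ≤ t) (ht1 : t ≤ 1) :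
    ((evolutionRemainder H t)ᴴ * evolutionRemainder H t).trace.re ≤ 2 ^ n * t ^ 4 := by
  set V : QubitOp n := (hH.eigenvectorUnitary : QubitOp n) with hV
  have hV1 : V * Vᴴ = 1 := Unitary.mul_star_self_of_mem hH.eigenvectorUnitary.2
  have hV2 : Vᴴ * V = 1 := Unitary.star_mul_self_of_mem hH.eigenvectorUnitary.2
  let D : QubitBasis n → ℂ := fun a => (hH.eigenvalues a : ℂ)
  have hsp : H = V * Matrix.diagonal D * Vᴴ := hH.spectral_theorem
  let c : ℂ := -(Complex.I * t)
  let f : QubitBasis n → ℂ := fun a => Complex.exp (c * D a) - 1 - c * D a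
  have hexp : evolutionOp H t = V * Matrix.diagonal (fun a => Complex.exp (c * D a)) * Vᴴ := by
    have h1 := Matrix.exp_units_conj ⟨V, Vᴴ, hV1, hV2⟩ (c • Matrix.diagonal D)
    simp only [Units.inv_mk] at h1
    rw [Matrix.mul_smul, Matrix.smul_mul, ← hsp] at h1
    rw [evolutionOp, h1, ← Matrix.diagonal_smul, Matrix.exp_diagonal]
    congr 3
    funext a
    rw [Pi.coe_exp, Complex.exp_eq_exp_ℂ]
    rfl
  have hR : evolutionRemainder H t = V * Matrix.diagonal f * Vᴴ := by
    have h1 : Matrix.diagonal f = Matrix.diagonal (fun a => Complex.exp (c * D a)) - 1 -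
        c • Matrix.diagonal D := by
      rw [← Matrix.diagonal_one, ← Matrix.diagonal_smul, Matrix.diagonal_sub, Matrix.diagonal_sub]
      rfl
    rw [evolutionRemainder, hexp, h1, mul_sub, mul_sub, sub_mul, sub_mul, mul_one, hV1,
      Matrix.mul_smul, Matrix.smul_mul, ← hsp]
  have htr : ((evolutionRemainder H t)ᴴ * evolutionRemainder H t).trace =
      ((∑ a, ‖f a‖ ^ 2 : ℝ) : ℂ) := by
    rw [hR, Matrix.conjTranspose_mul, Matrix.conjTranspose_mul, Matrix.conjTranspose_conjTranspose,
      Matrix.diagonal_conjTranspose]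
    calc (V * (Matrix.diagonal (star f) * Vᴴ) * (V * Matrix.diagonal f * Vᴴ)).trace
        = (V * (Matrix.diagonal (star f) * (Vᴴ * V) * Matrix.diagonal f * Vᴴ)).trace := by
          simp only [mul_assoc]
      _ = (Matrix.diagonal (star f) * Matrix.diagonal f).trace := by
          rw [hV2, mul_one, Matrix.trace_mul_comm, mul_assoc, hV2, mul_one]
      _ = _ := by
          rw [Matrix.diagonal_mul_diagonal, Matrix.trace_diagonal]
          push_cast
          exact Finset.sum_congr rfl fun a _ => Complex.conj_mul' _
  rw [htr, Complex.ofReal_re]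
  have hf : ∀ a, ‖f a‖ ^ 2 ≤ t ^ 4 := by
    intro a
    have hx : ‖c * D a‖ ≤ t := by
      have h1 : |hH.eigenvalues a| ≤ 1 := (abs_eigenvalues_le_opNorm hH a).trans hop
      simp only [c, D, norm_mul, norm_neg, Complex.norm_I, one_mul, Complex.norm_real,
        Real.norm_eq_abs, abs_of_nonneg ht0]
      exact mul_le_of_le_one_right ht0 h1
    have h2 : ‖f a‖ ≤ t ^ 2 :=
      (Complex.norm_exp_sub_one_sub_id_le (hx.trans ht1)).trans
        (pow_le_pow_left₀ (norm_nonneg _) hx 2)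
    calc ‖f a‖ ^ 2 ≤ (t ^ 2) ^ 2 := pow_le_pow_left₀ (norm_nonneg _) h2 2
      _ = t ^ 4 := by ring
  calc ∑ a, ‖f a‖ ^ 2 ≤ ∑ _a : QubitBasis n, t ^ 4 := Finset.sum_le_sum fun a _ => hf a
    _ = 2 ^ n * t ^ 4 := by simp

theorem sum_norm_pauliCoeff_evolutionRemainder_le {n : ℕ} {H : QubitOp n} (hH : H.IsHermitian)
    (hop : opNorm H ≤ 1) {t : ℝ} (ht0 : 0 ≤ t) (ht1 : t ≤ 1) (T : Finset (PauliLabel n)) :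
    ∑ p ∈ T, ‖pauliCoeff (evolutionRemainder H t) p‖ ^ 2 ≤ t ^ 4 := by
  have h := trace_evolutionRemainder_le hH hop ht0 ht1
  rw [trace_conjTranspose_mul_self_eq, Complex.ofReal_re] at h
  refine le_trans ?_ (le_of_mul_le_mul_left h (by positivity))
  exact Finset.sum_le_sum_of_subset_of_nonneg (Finset.subset_univ _) fun _ _ _ => by positivity

theorem pauliCoeff_evolutionOp {n : ℕ} (H : QubitOp n) (t : ℝ) {p : PauliLabel n} (hp : p ≠ 0) :
    pauliCoeff (evolutionOp H t) p =
      pauliCoeff (evolutionRemainder H t) p - Complex.I * t * pauliCoeff H p := by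
  rw [evolutionRemainder, pauliCoeff_sub, pauliCoeff_sub, pauliCoeff_smul,
    pauliCoeff_one_of_ne_zero hp]
  ring

/-- Under a Hamiltonian with the property, the evolution leaves the property to second order. -/
theorem sum_norm_pauliCoeff_evolutionOp_le {n : ℕ} {H : QubitOp n} (hop : opNorm H ≤ 1)
    {t : ℝ} (ht0 : 0 ≤ t) (ht1 : t ≤ 1) {T : Finset (PauliLabel n)} (hT : 0 ∈ T)
    (hprop : HasPauliProperty (T : Set (PauliLabel n)) H) :
    ∑ p ∈ Tᶜ, ‖pauliCoeff (evolutionOp H t) p‖ ^ 2 ≤ t ^ 4 := by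
  refine le_trans (le_of_eq ?_)
    (sum_norm_pauliCoeff_evolutionRemainder_le hprop.1 hop ht0 ht1 Tᶜ)
  refine Finset.sum_congr rfl fun p hp => ?_
  rw [Finset.mem_compl] at hp
  have hp0 : p ≠ 0 := (ne_of_mem_of_not_mem hT hp).symm
  rw [pauliCoeff_evolutionOp H t hp0, hprop.2 p (by simpa using hp), mul_zero,
    sub_zero]

/-- The distance to the property is attained at the truncation of the Pauli expansion. -/
theorem sq_le_sum_norm_pauliCoeff_of_isFarFrom {n : ℕ} {H : QubitOp n} (hH : H.IsHermitian)
    {T : Finset (PauliLabel n)} {ε : ℝ} (hε : 0 ≤ ε)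
    (hfar : IsFarFrom (T : Set (PauliLabel n)) ε H) :
    ε ^ 2 ≤ ∑ p ∈ Tᶜ, ‖pauliCoeff H p‖ ^ 2 := by
  classical
  let K : QubitOp n := ∑ p, (if p ∈ T then pauliCoeff H p else 0) • pauliString p
  have hK : ∀ p, pauliCoeff K p = if p ∈ T then pauliCoeff H p else 0 := fun p =>
    pauliCoeff_sum_smul _ p
  have hKp : HasPauliProperty (T : Set (PauliLabel n)) K := by
    refine ⟨?_, fun p hp => ?_⟩
    · rw [Matrix.IsHermitian, Matrix.conjTranspose_sum]
      refine Finset.sum_congr rfl fun p _ => ?_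
      rw [Matrix.conjTranspose_smul, pauliString_conjTranspose]
      congr 1
      split_ifs
      · exact star_pauliCoeff hH p
      · simp
    · rw [hK, if_neg (by simpa using hp)]
  have h := hfar K hKp
  have hs : schattenTwoNorm (H - K) =
      √((2 : ℝ) ^ n) * √(∑ p ∈ Tᶜ, ‖pauliCoeff H p‖ ^ 2) := by
    rw [schattenTwoNorm, trace_conjTranspose_mul_self_eq, Complex.ofReal_re,
      Real.sqrt_mul (by positivity)]
    congr 2
    rw [← Finset.sum_subset (Finset.subset_univ Tᶜ)]
    · refine Finset.sum_congr rfl fun p hp => ?_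
      rw [pauliCoeff_sub, hK, if_neg (by simpa using hp), sub_zero]
    · intro p _ hp
      rw [pauliCoeff_sub, hK, if_pos (by simpa using hp), sub_self]
      simp
  have h2 : √((2 : ℝ) ^ n) ≠ 0 := (Real.sqrt_pos.mpr (by positivity)).ne'
  rw [hs, ← mul_assoc, one_div_mul_cancel h2, one_mul] at h
  calc ε ^ 2 ≤ (√(∑ p ∈ Tᶜ, ‖pauliCoeff H p‖ ^ 2)) ^ 2 := pow_le_pow_left₀ hε h 2
    _ = _ := Real.sq_sqrt (Finset.sum_nonneg fun _ _ => by positivity)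

/-- Far from the property, the evolution leaves the property to first order. -/
theorem le_sum_norm_pauliCoeff_evolutionOp {n : ℕ} {H : QubitOp n} (hH : H.IsHermitian)
    (hop : opNorm H ≤ 1) {ε : ℝ} (hε0 : 0 < ε) (hε1 : ε < 1)
    {T : Finset (PauliLabel n)} (hT : 0 ∈ T) (hfar : IsFarFrom (T : Set (PauliLabel n)) ε H) :
    25 / 36 * (testerTime ε ^ 2 * ε ^ 2) ≤
      ∑ p ∈ Tᶜ, ‖pauliCoeff (evolutionOp H (testerTime ε)) p‖ ^ 2 := by
  set t := testerTime ε with ht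
  have ht6 : ε = 6 * t := by rw [ht, testerTime]; ring
  have ht0 : 0 ≤ t := by linarith
  have ht1 : t ≤ 1 := by linarith
  have h1 := sq_le_sum_norm_pauliCoeff_of_isFarFrom hH hε0.le hfar
  have h2 := sum_norm_pauliCoeff_evolutionRemainder_le hH hop ht0 ht1 Tᶜ
  have h3 : t ^ 2 * ∑ p ∈ Tᶜ, ‖pauliCoeff H p‖ ^ 2 ≤
      6 / 5 * ∑ p ∈ Tᶜ, ‖pauliCoeff (evolutionOp H t) p‖ ^ 2 +
      6 * ∑ p ∈ Tᶜ, ‖pauliCoeff (evolutionRemainder H t) p‖ ^ 2 := by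
    rw [Finset.mul_sum, Finset.mul_sum, Finset.mul_sum, ← Finset.sum_add_distrib]
    refine Finset.sum_le_sum fun p hp => ?_
    rw [Finset.mem_compl] at hp
    have hu := pauliCoeff_evolutionOp H t (ne_of_mem_of_not_mem hT hp).symm
    have hx : t * ‖pauliCoeff H p‖ ≤ ‖pauliCoeff (evolutionOp H t) p‖ +
        ‖pauliCoeff (evolutionRemainder H t) p‖ := by
      have : t * ‖pauliCoeff H p‖ = ‖pauliCoeff (evolutionOp H t) p -
          pauliCoeff (evolutionRemainder H t) p‖ := by
        rw [hu, sub_sub_cancel_left, norm_neg, norm_mul, norm_mul, Complex.norm_I, one_mul,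
          Complex.norm_real, Real.norm_eq_abs, abs_of_nonneg ht0]
      rw [this]
      exact norm_sub_le _ _
    have hx0 : 0 ≤ t * ‖pauliCoeff H p‖ := by positivity
    have hsq := pow_le_pow_left₀ hx0 hx 2
    -- The weights `6 / 5` and `6` are optimal, as the remainder is at most `t ^ 2 = t * ε / 6`.
    nlinarith [sq_nonneg (‖pauliCoeff (evolutionOp H t) p‖ -
      5 * ‖pauliCoeff (evolutionRemainder H t) p‖)]
  have h4 : t ^ 2 * ε ^ 2 ≤ t ^ 2 * ∑ p ∈ Tᶜ, ‖pauliCoeff H p‖ ^ 2 :=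
    mul_le_mul_of_nonneg_left h1 (by positivity)
  have h5 : t ^ 4 = t ^ 2 * ε ^ 2 / 36 := by rw [ht6]; ring
  linarith

/-! ### The acceptance probability of one round -/

namespace StabilizerCover

variable {n : ℕ} (B : StabilizerCover n)

/-- The coset of `r` modulo the group of basis `i` meets `T`. -/
def CosetMeets (T : Finset (PauliLabel n)) (i : Fin (2 ^ n + 1)) (r : PauliLabel n) : Prop :=
  ∃ p ∈ T, r + p ∈ B.group i

theorem cosetMeets_congr (T : Finset (PauliLabel n)) (i : Fin (2 ^ n + 1)) (r r' : PauliLabel n)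
    (h : r + r' ∈ B.group i) : B.CosetMeets T i r ↔ B.CosetMeets T i r' := by
  have key : ∀ a b : PauliLabel n, a + b ∈ B.group i → B.CosetMeets T i a →
      B.CosetMeets T i b := by
    rintro a b hab ⟨p, hp, hg⟩
    refine ⟨p, hp, ?_⟩
    have h1 := (B.group i).add_mem hab hg
    have h2 : a + b + (a + p) = a + a + (b + p) := by abel
    rwa [h2, pauliLabel_add_self, zero_add] at h1
  exact ⟨key r r' h, key r' r (by rwa [add_comm])⟩

open Classical in
/-- Two distinct strings are in one coset of at most one of the groups, so a string outside `T`
is confused with a string of `T` in at most `T.card` bases. -/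
theorem card_filter_cosetMeets_le (T : Finset (PauliLabel n)) {r : PauliLabel n} (hr : r ∉ T) :
    (Finset.univ.filter fun i => B.CosetMeets T i r).card ≤ T.card := by
  have hsub : (Finset.univ.filter fun i => B.CosetMeets T i r) ⊆
      T.biUnion fun p => Finset.univ.filter fun i => r + p ∈ B.group i := by
    intro i hi
    obtain ⟨p, hp, hg⟩ := (Finset.mem_filter.mp hi).2
    exact Finset.mem_biUnion.mpr ⟨p, hp, Finset.mem_filter.mpr ⟨Finset.mem_univ i, hg⟩⟩
  refine (Finset.card_le_card hsub).trans ((Finset.card_biUnion_le_card_mul _ _ 1 ?_).trans ?_)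
  · intro p hp
    rw [Finset.card_le_one]
    intro i hi i' hi'
    by_contra hne
    have h1 : r + p ∈ B.group i ⊓ B.group i' :=
      ⟨(Finset.mem_filter.mp hi).2, (Finset.mem_filter.mp hi').2⟩
    rw [B.group_inter i i' hne, AddSubgroup.mem_bot, pauliLabel_add_eq_zero_iff] at h1
    exact hr (h1 ▸ hp)
  · rw [mul_one]

open Classical in
/-- The probability of acceptance, when Pauli strings are distributed according to `w`. -/
noncomputable def acceptProb (T : Finset (PauliLabel n)) (w : PauliLabel n → ℝ) : ℝ :=
  (2 ^ n + 1 : ℝ)⁻¹ * ∑ i, ∑ p, if B.CosetMeets T i p then w p else 0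

theorem one_sub_le_acceptProb (T : Finset (PauliLabel n)) {w : PauliLabel n → ℝ}
    (hw : ∀ p, 0 ≤ w p) (hsum : ∑ p, w p = 1) :
    1 - ∑ p ∈ Tᶜ, w p ≤ B.acceptProb T w := by
  classical
  have h1 : ∀ i, 1 - ∑ p ∈ Tᶜ, w p ≤ ∑ p, if B.CosetMeets T i p then w p else 0 := by
    intro i
    rw [← hsum, ← Finset.sum_add_sum_compl T w, add_sub_cancel_right, ← Finset.sum_filter]
    refine Finset.sum_le_sum_of_subset_of_nonneg ?_ fun p _ _ => hw p
    intro p hp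
    refine Finset.mem_filter.mpr ⟨Finset.mem_univ p, p, hp, ?_⟩
    rw [pauliLabel_add_self]
    exact (B.group i).zero_mem
  rw [acceptProb, inv_mul_eq_div, le_div_iff₀ (by positivity)]
  calc (1 - ∑ p ∈ Tᶜ, w p) * (2 ^ n + 1) = ∑ _i : Fin (2 ^ n + 1), (1 - ∑ p ∈ Tᶜ, w p) := by
        simp
        ring
    _ ≤ _ := Finset.sum_le_sum fun i _ => h1 i

theorem acceptProb_le (T : Finset (PauliLabel n)) {w : PauliLabel n → ℝ}
    (hw : ∀ p, 0 ≤ w p) (hsum : ∑ p, w p = 1) :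
    B.acceptProb T w ≤ 1 - (1 - T.card / (2 ^ n + 1)) * ∑ p ∈ Tᶜ, w p := by
  classical
  have h1 : ∑ i, ∑ p, (if B.CosetMeets T i p then w p else 0) ≤
      (2 ^ n + 1) * ∑ p ∈ T, w p + T.card * ∑ p ∈ Tᶜ, w p := by
    rw [Finset.sum_comm, ← Finset.sum_add_sum_compl T, Finset.mul_sum, Finset.mul_sum]
    refine add_le_add (Finset.sum_le_sum fun p _ => ?_) (Finset.sum_le_sum fun p hp => ?_)
    · calc ∑ i, (if B.CosetMeets T i p then w p else 0) ≤ ∑ _i : Fin (2 ^ n + 1), w p := by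
            refine Finset.sum_le_sum fun i _ => ?_
            split_ifs
            · exact le_rfl
            · exact hw p
        _ = (2 ^ n + 1) * w p := by simp
    · rw [← Finset.sum_filter, Finset.sum_const, nsmul_eq_mul]
      refine mul_le_mul_of_nonneg_right ?_ (hw p)
      exact_mod_cast B.card_filter_cosetMeets_le T (Finset.mem_compl.mp hp)
  have h2 : ∑ p ∈ T, w p = 1 - ∑ p ∈ Tᶜ, w p := by
    rw [← hsum, ← Finset.sum_add_sum_compl T w, add_sub_cancel_right]
  rw [acceptProb, inv_mul_eq_div, div_le_iff₀ (by positivity)]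
  refine h1.trans (le_of_eq ?_)
  rw [h2]
  field_simp
  ring

theorem experiment_toOuterMeasure_testAccepts {H : QubitOp n} (hH : H.IsHermitian) (t : ℝ)
    {prog : RamProgram} (hprog : DecidesPauliEquivalence prog) (L : List (PauliLabel n))
    (T : Finset (PauliLabel n)) (hT : ∀ p, p ∈ T ↔ p ∈ L) (h0 : 0 ∈ T) :
    (B.experiment H t).toOuterMeasure {x | B.testAccepts prog L x.1 x.2.1 x.2.2 = true} =
      ENNReal.ofReal (B.acceptProb T fun p => ‖pauliCoeff (evolutionOp H t) p‖ ^ 2) := by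
  rw [acceptProb, ← B.experiment_toOuterMeasure hH t (B.CosetMeets T) (B.cosetMeets_congr T)]
  congr 1
  ext x
  simp only [Set.mem_ofPred_eq]
  rw [hprog, pauliEquivalent_ket_iff]
  refine exists_congr fun P => and_congr_left fun _ => ?_
  rw [hT]
  constructor
  · rintro (h | h)
    · exact h
    · rw [Set.mem_singleton_iff] at h
      rw [h]
      exact (hT 0).mp h0
  · exact Or.inl

/-! ### Repetition -/

theorem rounds_toOuterMeasure_null (prog : RamProgram) (L : List (PauliLabel n)) (H : QubitOp n)
    (t : ℝ) (N : ℕ) :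
    (B.rounds prog L H t N).toOuterMeasure {r | r.verdict = Verdict.null} =
      ((B.experiment H t).toOuterMeasure
        {x | B.testAccepts prog L x.1 x.2.1 x.2.2 = true}) ^ N := by
  induction N with
  | zero => simp [rounds, PMF.toOuterMeasure_pure_apply]
  | succ N ih =>
    rw [rounds, PMF.toOuterMeasure_bind_apply, pow_succ', ← ih,
      PMF.toOuterMeasure_apply (p := B.experiment H t), ← ENNReal.tsum_mul_right]
    refine tsum_congr fun x => ?_
    by_cases h : B.testAccepts prog L x.1 x.2.1 x.2.2 = true
    · rw [if_pos h, PMF.toOuterMeasure_map_apply,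
        Set.indicator_of_mem (show x ∈ {x | B.testAccepts prog L x.1 x.2.1 x.2.2 = true} from h)]
      rfl
    · rw [if_neg h, PMF.toOuterMeasure_pure_apply,
        Set.indicator_of_notMem (show x ∉ {x | B.testAccepts prog L x.1 x.2.1 x.2.2 = true} from h)]
      simp

end StabilizerCover

theorem PMF.toOuterMeasure_add_compl {α : Type*} (p : PMF α) (s : Set α) :
    p.toOuterMeasure s + p.toOuterMeasure sᶜ = 1 := by
  rw [PMF.toOuterMeasure_apply, PMF.toOuterMeasure_apply, ← ENNReal.tsum_add, ← p.tsum_coe]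
  refine tsum_congr fun x => ?_
  exact congrFun (Set.indicator_self_add_compl s p) x

theorem toOuterMeasure_verdict_alternate (p : PMF TesterRun) :
    p.toOuterMeasure {r | r.verdict = Verdict.alternate} =
      1 - p.toOuterMeasure {r | r.verdict = Verdict.null} := by
  have h : {r : TesterRun | r.verdict = Verdict.alternate} =
      {r | r.verdict = Verdict.null}ᶜ := by
    ext r
    simp only [Set.mem_ofPred_eq, Set.mem_compl_iff]
    cases r.verdict <;> simp
  have h1 := p.toOuterMeasure_add_compl {r | r.verdict = Verdict.null}
  rw [h]
  refine ENNReal.eq_sub_of_add_eq' ENNReal.one_ne_top ?_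
  rw [add_comm]
  exact h1

theorem StabilizerCover.rounds_resources {n : ℕ} (B : StabilizerCover n) (prog : RamProgram)
    (L : List (PauliLabel n)) (H : QubitOp n) {t : ℝ} (ht : 0 ≤ t) {τ : ℕ}
    (hτ : ∀ i j l, B.testTime prog L i j l ≤ τ) (N : ℕ) :
    ∀ r ∈ (B.rounds prog L H t N).support,
      r.experiments ≤ N ∧ r.evolutionTime ≤ N * t ∧ r.classicalTime ≤ N * (τ + 1) := by
  induction N with
  | zero =>
    intro r hr
    rw [rounds, PMF.support_pure, Set.mem_singleton_iff] at hr
    simp [hr]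
  | succ N ih =>
    intro r hr
    rw [rounds, PMF.mem_support_bind_iff] at hr
    obtain ⟨x, -, hr⟩ := hr
    have hx := hτ x.1 x.2.1 x.2.2
    split_ifs at hr
    · rw [PMF.mem_support_map_iff] at hr
      obtain ⟨r', hr', rfl⟩ := hr
      obtain ⟨h1, h2, h3⟩ := ih r' hr'
      refine ⟨Nat.succ_le_succ h1, ?_, ?_⟩
      · push_cast
        linarith
      · dsimp only
        rw [Nat.succ_mul]
        omega
    · rw [PMF.support_pure, Set.mem_singleton_iff] at hr
      subst hr
      refine ⟨Nat.le_add_left 1 N, ?_, ?_⟩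
      · push_cast
        nlinarith [Nat.cast_nonneg (α := ℝ) N]
      · dsimp only
        rw [Nat.succ_mul]
        omega

/-! ### Local Pauli strings -/

theorem pauliWeight_zero {n : ℕ} : pauliWeight (0 : PauliLabel n) = 0 := by
  simp [pauliWeight]

theorem card_pauliWeight_le {n : ℕ} (hn : 1 ≤ n) (k : ℕ) :
    (Finset.univ.filter fun P : PauliLabel n => pauliWeight P ≤ k).card + 1 ≤
      (3 * n) ^ (k + 1) := by
  classical
  induction k with
  | zero =>
    have h : (Finset.univ.filter fun P : PauliLabel n => pauliWeight P ≤ 0) ⊆ {0} := by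
      intro P hP
      have h1 := (Finset.mem_filter.mp hP).2
      rw [Nat.le_zero, pauliWeight, Finset.card_eq_zero, Finset.filter_eq_empty_iff] at h1
      rw [Finset.mem_singleton]
      funext q
      exact not_not.mp (h1 (Finset.mem_univ q))
    have h2 := Finset.card_le_card h
    rw [Finset.card_singleton] at h2
    rw [zero_add, pow_one]
    omega
  | succ k ih =>
    set F := Finset.univ.filter fun P : PauliLabel n => pauliWeight P ≤ k
    let E : Finset (ZMod 2 × ZMod 2) := Finset.univ.filter fun p => p ≠ 0
    have hE : E.card = 3 := by decide
    -- A nonzero string arises from a string of smaller weight by setting one of its factors.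
    have hsub : (Finset.univ.filter fun P : PauliLabel n => pauliWeight P ≤ k + 1) ⊆
        insert 0 ((F ×ˢ (Finset.univ : Finset (Fin n)) ×ˢ E).image
          fun x => Function.update x.1 x.2.1 x.2.2) := by
      intro P hP
      have hPk := (Finset.mem_filter.mp hP).2
      rw [Finset.mem_insert]
      by_cases h0 : P = 0
      · exact Or.inl h0
      right
      obtain ⟨q, hq⟩ := Function.ne_iff.mp h0
      rw [Finset.mem_image]
      refine ⟨(Function.update P q 0, q, P q), ?_, by simp⟩
      rw [Finset.mem_product, Finset.mem_product]
      refine ⟨Finset.mem_filter.mpr ⟨Finset.mem_univ _, ?_⟩, Finset.mem_univ _,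
        Finset.mem_filter.mpr ⟨Finset.mem_univ _, hq⟩⟩
      have hlt : pauliWeight (Function.update P q 0) < pauliWeight P := by
        refine Finset.card_lt_card (Finset.ssubset_iff_of_subset ?_ |>.mpr ⟨q, ?_, ?_⟩)
        · intro q' hq'
          have h1 := (Finset.mem_filter.mp hq').2
          refine Finset.mem_filter.mpr ⟨Finset.mem_univ _, ?_⟩
          by_cases e : q' = q
          · subst e; simp at h1
          · rwa [Function.update_of_ne e] at h1
        · exact Finset.mem_filter.mpr ⟨Finset.mem_univ _, hq⟩
        · simp
      exact Nat.le_of_lt_succ (hlt.trans_le hPk)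
    have h1 := (Finset.card_le_card hsub).trans ((Finset.card_insert_le _ _).trans
      (Nat.succ_le_succ Finset.card_image_le))
    rw [Finset.card_product, Finset.card_product, Finset.card_univ, Fintype.card_fin, hE] at h1
    calc _ ≤ F.card * (n * 3) + 1 + 1 := Nat.succ_le_succ h1
      _ ≤ (F.card + 1) * (3 * n) := by rw [add_mul, one_mul, mul_comm n 3]; omega
      _ ≤ (3 * n) ^ (k + 1) * (3 * n) := Nat.mul_le_mul_right _ ih
      _ = _ := (pow_succ _ _).symm

/-! ### Numerical estimates -/

theorem testerRounds_bounds {ε : ℝ} (hε0 : 0 < ε) :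
    2 * Real.log 3 ≤ testerRounds ε * (testerTime ε ^ 2 * ε ^ 2) ∧
      testerRounds ε * (testerTime ε ^ 2 * ε ^ 2) ≤ 4 + testerTime ε ^ 2 * ε ^ 2 := by
  have ht : 0 < testerTime ε ^ 2 * ε ^ 2 := by
    have : 0 < testerTime ε := by rw [testerTime]; positivity
    positivity
  have hlog : Real.log 3 ≤ 2 := by
    have := Real.log_le_sub_one_of_pos (show (0 : ℝ) < 3 by norm_num)
    linarith
  have hlog0 : 0 ≤ Real.log 3 := Real.log_nonneg (by norm_num)
  constructor
  · have h := Nat.le_ceil (2 * Real.log 3 / (testerTime ε ^ 2 * ε ^ 2))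
    rwa [div_le_iff₀ ht] at h
  · have h := (Nat.ceil_lt_add_one
      (show 0 ≤ 2 * Real.log 3 / (testerTime ε ^ 2 * ε ^ 2) by positivity)).le
    calc (testerRounds ε : ℝ) * (testerTime ε ^ 2 * ε ^ 2)
        ≤ (2 * Real.log 3 / (testerTime ε ^ 2 * ε ^ 2) + 1) * (testerTime ε ^ 2 * ε ^ 2) :=
          mul_le_mul_of_nonneg_right h ht.le
      _ = 2 * Real.log 3 + testerTime ε ^ 2 * ε ^ 2 := by
          rw [add_mul, one_mul, div_mul_cancel₀ _ ht.ne']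
      _ ≤ _ := by linarith

theorem testerRounds_le {ε : ℝ} (hε0 : 0 < ε) (hε1 : ε < 1) :
    (testerRounds ε : ℝ) ≤ 145 / ε ^ 4 := by
  have h := (testerRounds_bounds hε0).2
  rw [testerTime] at h
  rw [le_div_iff₀ (by positivity)]
  have h4 : ε ^ 4 ≤ 1 := pow_le_one₀ hε0.le hε1.le
  nlinarith

/-- By Bernoulli's inequality, rounds with rejection probability at most `t ^ 4` all accept with
probability at least `2 / 3`. -/
theorem two_thirds_le_pow_testerRounds {ε : ℝ} (hε0 : 0 < ε) (hε1 : ε < 1) {a : ℝ}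
    (ha : 1 - testerTime ε ^ 4 ≤ a) : 2 / 3 ≤ a ^ testerRounds ε := by
  have h := (testerRounds_bounds hε0).2
  have ht4 : testerTime ε ^ 4 = testerTime ε ^ 2 * ε ^ 2 / 36 := by rw [testerTime]; ring
  have hsmall : testerTime ε ^ 2 * ε ^ 2 ≤ 1 := by
    rw [testerTime, show (ε / 6) ^ 2 * ε ^ 2 = ε ^ 4 / 36 by ring]
    have h4 : ε ^ 4 ≤ 1 := pow_le_one₀ hε0.le hε1.le
    linarith
  have h1 := one_add_mul_le_pow (a := -testerTime ε ^ 4) (by rw [ht4]; linarith) (testerRounds ε)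
  have h2 : (1 + -testerTime ε ^ 4) ^ testerRounds ε ≤ a ^ testerRounds ε :=
    pow_le_pow_left₀ (by rw [ht4]; linarith) (by linarith) _
  refine le_trans ?_ (h1.trans h2)
  rw [ht4]
  nlinarith

/-- The factor `143 / 144` accounts for the strings outside the property that share a coset with
one in it. The margin `2 * 143 / 144 * 25 / 36 ≥ 1` in the exponent absorbs it. -/
theorem pow_testerRounds_le_third {ε : ℝ} (hε0 : 0 < ε) {a : ℝ} (ha0 : 0 ≤ a)
    (ha : a ≤ 1 - 143 / 144 * (25 / 36 * (testerTime ε ^ 2 * ε ^ 2))) :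
    a ^ testerRounds ε ≤ 1 / 3 := by
  have h := (testerRounds_bounds hε0).1
  set y := testerTime ε ^ 2 * ε ^ 2
  have hlog0 : 0 ≤ Real.log 3 := Real.log_nonneg (by norm_num)
  have h1 : a ≤ Real.exp (-(143 / 144 * (25 / 36 * y))) := by
    have := Real.add_one_le_exp (-(143 / 144 * (25 / 36 * y)))
    linarith
  calc a ^ testerRounds ε ≤ Real.exp (-(143 / 144 * (25 / 36 * y))) ^ testerRounds ε :=
        pow_le_pow_left₀ ha0 h1 _
    _ = Real.exp (testerRounds ε * -(143 / 144 * (25 / 36 * y))) := (Real.exp_nat_mul _ _).symm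
    _ ≤ Real.exp (-Real.log 3) := by
        apply Real.exp_le_exp.mpr
        nlinarith
    _ = 1 / 3 := by rw [Real.exp_neg, Real.exp_log (by norm_num), one_div]

/-- The bound on the time of one test in terms of the bound `(3 n) ^ (k + 1)` on the number of
local strings. -/
theorem testTime_local_le {n k : ℕ} (hn : 1 ≤ n) (B : StabilizerCover n)
    (L : List (PauliLabel n)) (hL : L.length ≤ (3 * n) ^ (k + 1)) (i : Fin (2 ^ n + 1))
    (j l : Fin (2 ^ n)) :
    B.testTime RamProgram.pauliEquivalenceProgram L i j l + 1 ≤ 146 * (3 * n) ^ (k + 3) := by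
  have h := B.testTime_le L i j l
  set X := (3 * n) ^ (k + 1) with hX
  have hX1 : 1 ≤ X := Nat.one_le_pow _ _ (by omega)
  have hn2 : n ≤ n * n := Nat.le_mul_of_pos_left n hn
  have e : (3 * n) ^ (k + 3) = X * (9 * (n * n)) := by rw [hX]; ring
  have h1 : 1 ≤ n * n := hn.trans hn2
  have h2 : L.length * (7 + 13 * n + 41 * (n * n)) ≤ X * (61 * (n * n)) :=
    Nat.mul_le_mul hL (by omega)
  have h3 : 16 + 23 * n + 46 * (n * n) ≤ X * (85 * (n * n)) :=
    le_trans (by omega) (Nat.le_mul_of_pos_left _ hX1)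
  have h4 : X * (61 * (n * n)) + X * (85 * (n * n)) ≤ 146 * (X * (9 * (n * n))) := by
    have : X * (61 * (n * n)) + X * (85 * (n * n)) = 146 * (X * (n * n)) := by ring
    rw [this]
    exact Nat.mul_le_mul_left _ (Nat.mul_le_mul_left _ (by omega))
  rw [e]
  omega

theorem mainTheorem5 :
    (∀ n : ℕ, 2 ≤ n → Nonempty (StabilizerCover n)) ∧
    ∃ (prog : RamProgram) (C : ℝ), DecidesPauliEquivalence prog ∧
      ∀ (n k : ℕ) (ε : ℝ), 2 ≤ n → 0 < ε → ε < 1 →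
        (3 * (n : ℝ)) ^ (k + 1) ≤ (2 ^ n + 1) * ε ^ 4 / 144 →
        ∀ (B : StabilizerCover n) (L : List (PauliLabel n)),
          L.Nodup → {P | P ∈ L} = localPaulis n k →
          ∀ H : QubitOp n, H.IsHermitian → H.trace = 0 → opNorm H ≤ 1 →
            (HasPauliProperty (localPaulis n k) H →
              2 / 3 ≤ (B.tester prog L ε H).toOuterMeasure {r | r.verdict = Verdict.null}) ∧
            (IsFarFrom (localPaulis n k) ε H →
              2 / 3 ≤ (B.tester prog L ε H).toOuterMeasure {r | r.verdict = Verdict.alternate}) ∧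
            (testerRounds ε : ℝ) ≤ C / ε ^ 4 ∧
            ∀ r ∈ (B.tester prog L ε H).support,
              r.experiments ≤ testerRounds ε ∧
              r.evolutionTime ≤ C / ε ^ 3 ∧
              (r.classicalTime : ℝ) ≤ C * (3 * (n : ℝ)) ^ (k + 3) / ε ^ 4 := by
  classical
  refine ⟨fun n hn => nonempty_stabilizerCover (by omega), RamProgram.pauliEquivalenceProgram,
    -- The factors bound `ε ^ 4` times the number of rounds, and the time of a round.
    145 * 146, decidesPauliEquivalence_pauliEquivalenceProgram, ?_⟩
  intro n k ε hn hε0 hε1 hk B L hnodup hL H hH _ hop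
  have hprog := decidesPauliEquivalence_pauliEquivalenceProgram
  set T := Finset.univ.filter fun P : PauliLabel n => pauliWeight P ≤ k with hTdef
  have hTL : ∀ p, p ∈ T ↔ p ∈ L := by
    intro p
    have h1 : p ∈ {P | P ∈ L} ↔ p ∈ localPaulis n k := by rw [hL]
    rw [hTdef, Finset.mem_filter, and_iff_right (Finset.mem_univ p)]
    exact h1.symm
  have hTS : localPaulis n k = (T : Set (PauliLabel n)) := by
    rw [← hL]
    ext p
    exact (hTL p).symm
  have hT0 : 0 ∈ T := by simp [hTdef, pauliWeight_zero]
  have hlen : L.length = T.card := by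
    rw [← List.toFinset_card_of_nodup hnodup]
    congr 1
    ext p
    rw [List.mem_toFinset, hTL]
  have hcard : T.card ≤ (3 * n) ^ (k + 1) :=
    (Nat.le_succ _).trans (card_pauliWeight_le (by omega) k)
  have hratio : (T.card : ℝ) / (2 ^ n + 1) ≤ 1 / 144 := by
    rw [div_le_iff₀ (by positivity)]
    have h1 : (T.card : ℝ) ≤ (3 * (n : ℝ)) ^ (k + 1) := by exact_mod_cast hcard
    have h4 : ε ^ 4 ≤ 1 := pow_le_one₀ hε0.le hε1.le
    have h5 : (2 ^ n + 1 : ℝ) * ε ^ 4 ≤ (2 ^ n + 1) * 1 :=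
      mul_le_mul_of_nonneg_left h4 (by positivity)
    linarith
  set t := testerTime ε with ht
  have ht0 : 0 ≤ t := by rw [ht, testerTime]; positivity
  have ht1 : t ≤ 1 := by rw [ht, testerTime]; linarith
  set w : PauliLabel n → ℝ := fun p => ‖pauliCoeff (evolutionOp H t) p‖ ^ 2 with hw
  have hw0 : ∀ p, 0 ≤ w p := fun p => by positivity
  have hw1 : ∑ p, w p = 1 := sum_norm_pauliCoeff_sq (evolutionOp_conjTranspose_mul_self hH t)
  have ha0 : 0 ≤ B.acceptProb T w :=
    mul_nonneg (by positivity) (Finset.sum_nonneg fun i _ => Finset.sum_nonneg fun p _ => by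
      split_ifs
      · exact hw0 p
      · exact le_rfl)
  have hnull : (B.tester RamProgram.pauliEquivalenceProgram L ε H).toOuterMeasure
      {r | r.verdict = Verdict.null} = ENNReal.ofReal (B.acceptProb T w ^ testerRounds ε) := by
    rw [StabilizerCover.tester, B.rounds_toOuterMeasure_null,
      B.experiment_toOuterMeasure_testAccepts hH _ hprog L T hTL hT0, ENNReal.ofReal_pow ha0]
  have h23 : (2 / 3 : ENNReal) = ENNReal.ofReal (2 / 3) := by
    rw [ENNReal.ofReal_div_of_pos (by norm_num)]
    norm_num
  have hN := testerRounds_le hε0 hε1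
  refine ⟨fun hloc => ?_, fun hfar => ?_, ?_, ?_⟩
  · rw [hTS] at hloc
    rw [hnull, h23]
    refine ENNReal.ofReal_le_ofReal (two_thirds_le_pow_testerRounds hε0 hε1 ?_)
    have h1 := sum_norm_pauliCoeff_evolutionOp_le hop ht0 ht1 hT0 hloc
    exact le_trans (by linarith) (B.one_sub_le_acceptProb T hw0 hw1)
  · rw [hTS] at hfar
    have h1 := le_sum_norm_pauliCoeff_evolutionOp hH hop hε0 hε1 hT0 hfar
    have h2 : B.acceptProb T w ≤ 1 - 143 / 144 * (25 / 36 * (t ^ 2 * ε ^ 2)) := by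
      refine (B.acceptProb_le T hw0 hw1).trans (sub_le_sub_left ?_ 1)
      exact mul_le_mul (by linarith) h1 (by positivity) (by linarith)
    have h3 := pow_testerRounds_le_third hε0 ha0 h2
    rw [toOuterMeasure_verdict_alternate, hnull, h23, ← ENNReal.ofReal_one,
      ← ENNReal.ofReal_sub _ (pow_nonneg ha0 _)]
    exact ENNReal.ofReal_le_ofReal (by linarith)
  · exact hN.trans (div_le_div_of_nonneg_right (by norm_num) (by positivity))
  · intro r hr
    obtain ⟨h1, h2, h3⟩ := B.rounds_resources RamProgram.pauliEquivalenceProgram L H ht0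
      (τ := 146 * (3 * n) ^ (k + 3) - 1)
      (fun i j l => Nat.le_sub_one_of_lt
        (testTime_local_le (by omega) B L (hlen ▸ hcard) i j l)) (testerRounds ε) r hr
    refine ⟨h1, h2.trans ?_, ?_⟩
    · calc (testerRounds ε : ℝ) * t ≤ 145 / ε ^ 4 * t := mul_le_mul_of_nonneg_right hN ht0
        _ = 145 / 6 / ε ^ 3 := by rw [ht, testerTime]; field_simp
        _ ≤ 145 * 146 / ε ^ 3 := div_le_div_of_nonneg_right (by norm_num) (by positivity)
    · have hpos : 1 ≤ 146 * (3 * n) ^ (k + 3) := by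
        have := Nat.one_le_pow (k + 3) (3 * n) (by omega)
        omega
      rw [Nat.sub_add_cancel hpos] at h3
      have h4 : (r.classicalTime : ℝ) ≤ testerRounds ε * (146 * (3 * (n : ℝ)) ^ (k + 3)) := by
        exact_mod_cast h3
      calc (r.classicalTime : ℝ) ≤ testerRounds ε * (146 * (3 * (n : ℝ)) ^ (k + 3)) := h4
        _ ≤ 145 / ε ^ 4 * (146 * (3 * (n : ℝ)) ^ (k + 3)) :=
          mul_le_mul_of_nonneg_right hN (by positivity)
        _ = _ := by ring
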